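/- Let $k$ be a field. Let $X_0=\mathbb{P}^2_k$ with homogeneous coordinates $X,Y,Z$ and affine coordinates $x=X/Z$, $y=Y/Z$, let $\Delta=(XYZ=0)$ and $L=(Y=0)$, and let $X_1$ be the blowup of $\mathbb{P}^2_k$ at the point $[1:0:1]$, with exceptional divisor $E_1$. For each $i\ge 1$, let $X_{i+1}$ be the blowup of $X_i$ at a point which is an intersection point of two of the curves $\widetilde L,\widetilde{E_1},\ldots,\widetilde{E_{i-1}},E_i$ on $X_i$ (tildes denote strict transforms), with exceptional divisor $E_{i+1}$. Write $\pi$ for the blowup morphisms from $X_n$ to the earlier stages $X_i$ and to $\mathbb{P}^2_k$. (i) For every $n\ge 2$ there is a largest normal crossings divisor on $X_n$ (normal crossings divisors being effective and reduced) whose image in $\mathbb{P}^2_k$ is contained in $\Delta$. It has strict normal crossings, and it is equal, as a Cartier divisor, to $$D_n=\pi^*(\Delta)-\pi^*(E_2)-\cdots-\pi^*(E_{n-1})-E_n .$$ (ii) Suppose moreover that, for every $i\ge 1$, the point of $X_i$ that is blown up to obtain $X_{i+1}$ lies on $E_i$, the most recently created exceptional divisor. Then for every $n\ge 1$ there are neighboring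 fractions $\frac{a_n}{b_n}<\frac{c_n}{d_n}$ on level $n$ of the Stern--Brocot tree such that $X_{n+1}$ is the blowup of $X_n$ along the ideal sheaf of a point near which this ideal sheaf is generated by the two rational functions $$\frac{(x-1)^{b_n}}{y^{a_n}},\qquad \frac{y^{c_n}}{(x-1)^{d_n}},$$ which are regular there. Here level $1$ of the tree consists of $\frac01,\frac11$, and level $m+1$ arises from level $m$ by inserting the mediant $\frac{a+c}{b+d}$ between any two neighbors $\frac ab,\frac cd$. -/

import Mathlib

open AlgebraicGeometry CategoryTheory TopologicalSpace

universe u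

noncomputable section

attribute [local instance] MvPolynomial.gradedAlgebra

/-! ### The Stern–Brocot tree between `0/1` and `1/1` -/

/-- Insert the mediant between every two consecutive fractions of a list.
A fraction `a/b` is stored as the pair `(a, b)`. -/
def insertMediants : List (ℕ × ℕ) → List (ℕ × ℕ)
  | p :: q :: l => p :: (p.1 + q.1, p.2 + q.2) :: insertMediants (q :: l)
  | l => l

/-- The fractions on level `n ≥ 1` of the tree, in increasing order (level `1` is `0/1, 1/1`;
there is no level `0`). -/
def sternBrocotLevel : ℕ → List (ℕ × ℕ)
  | 0 => []
  | 1 => [(0, 1), (1, 1)]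
  | n + 2 => insertMediants (sternBrocotLevel (n + 1))

/-- `a/b` and `c/d` are neighbours on level `n`, `a/b` being the left one. -/
def FareyNeighbors (n a b c d : ℕ) : Prop :=
  [(a, b), (c, d)] <:+: sternBrocotLevel n

/-! ### Effective divisors and blowups

Effective Cartier divisors are handled through their ideal sheaves. A divisor `D` corresponds to
the invertible ideal sheaf `𝒪(-D)`, so addition of divisors is multiplication of ideal sheaves,
the zero divisor is `⊤`, `D ≤ D'` is `𝒪(-D') ≤ 𝒪(-D)`, and the pullback of `D` along a morphism
`f` is the inverse image ideal sheaf `𝒪(-D).comap f`. -/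

/-- The ideal sheaf is that of an effective Cartier divisor: locally it is generated by one
non-zero-divisor. -/
def IsEffectiveCartier {X : Scheme.{u}} (I : X.IdealSheafData) : Prop :=
  ∀ x : X, ∃ U : X.affineOpens, x ∈ U.1 ∧
    ∃ f ∈ nonZeroDivisors Γ(X, U.1), I.ideal U = Ideal.span {f}

/-- `π : X' ⟶ X` is the blowup of `X` along the ideal sheaf `I`: the inverse image of `I` is
invertible, and `π` is universal with this property. -/
structure IsBlowup {X' X : Scheme.{u}} (π : X' ⟶ X) (I : X.IdealSheafData) : Prop where
  invertible : IsEffectiveCartier (I.comap π)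
  existsUnique_lift : ∀ (Y : Scheme.{u}) (f : Y ⟶ X), IsEffectiveCartier (I.comap f) →
    ∃! g : Y ⟶ X', g ≫ π = f

/-- The divisor of the ideal sheaf `I` has strict normal crossings: at each of its points `x` the
local ring is regular, and the divisor is given there by the product of some of the members of a
regular system of parameters. -/
def IsStrictNormalCrossings {X : Scheme.{u}} (I : X.IdealSheafData) : Prop :=
  ∀ x ∈ I.support, IsRegularLocalRing (X.presheaf.stalk x) ∧
    ∃ (d : ℕ) (t : Fin d → X.presheaf.stalk x) (s : Finset (Fin d)),
      ringKrullDim (X.presheaf.stalk x) = d ∧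
      Ideal.span (Set.range t) = IsLocalRing.maximalIdeal (X.presheaf.stalk x) ∧
      ∃ (U : X.affineOpens) (hx : x ∈ U.1),
        (I.ideal U).map (X.presheaf.germ U.1 x hx).hom = Ideal.span {∏ i ∈ s, t i}

/-- The ideal sheaf `I` is that of a normal crossings divisor: an effective Cartier divisor that
is reduced and has strict normal crossings étale-locally. -/
structure IsNormalCrossings {X : Scheme.{u}} (I : X.IdealSheafData) : Prop where
  cartier : IsEffectiveCartier I
  reduced : I.radical = I
  locally_strict : ∀ x : X, ∃ (V : Scheme.{u}) (φ : V ⟶ X), Etale φ ∧ x ∈ Set.range φ ∧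
    IsStrictNormalCrossings (I.comap φ)

/-! ### The projective plane with its coordinate lines -/

section Plane

variable (k : Type u) [Field k]

/-- The projective plane over `k`. The homogeneous coordinates `X, Y, Z` are the variables with
index `0, 1, 2`. -/
abbrev Plane : Scheme.{u} := Proj (MvPolynomial.homogeneousSubmodule (Fin 3) k)

/-- The coordinate line on which the `i`-th homogeneous coordinate vanishes. -/
def coordLine (i : Fin 3) : Closeds (Plane k) where
  carrier := {x | (MvPolynomial.X i : MvPolynomial (Fin 3) k) ∈ x.asHomogeneousIdeal}
  isClosed' := by
    have h := (Proj.basicOpen (MvPolynomial.homogeneousSubmodule (Fin 3) k)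
      (MvPolynomial.X i)).isOpen.isClosed_compl
    convert! h using 1
    ext x
    simp [Proj.mem_basicOpen]

/-- The divisor `Δ = (XYZ = 0)`, that is, the sum of the three coordinate lines. -/
def triangle : (Plane k).IdealSheafData :=
  ∏ i : Fin 3, Scheme.IdealSheafData.vanishingIdeal (coordLine k i)

/-- The affine chart `Z ≠ 0` of the plane. -/
def chartZ : (Plane k).Opens :=
  Proj.basicOpen (MvPolynomial.homogeneousSubmodule (Fin 3) k) (MvPolynomial.X 2)

/-- The regular function `T_i / Z` on the chart `Z ≠ 0`, for the homogeneous coordinate `T_i`. -/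
def affineCoord (i : Fin 3) : Γ(Plane k, chartZ k) :=
  (Proj.awayToSection (MvPolynomial.homogeneousSubmodule (Fin 3) k) (MvPolynomial.X 2)).hom
    (HomogeneousLocalization.Away.mk (MvPolynomial.homogeneousSubmodule (Fin 3) k)
      (f := MvPolynomial.X 2) (d := 1)
      ((MvPolynomial.mem_homogeneousSubmodule _ _).2 (MvPolynomial.isHomogeneous_X k 2)) 1
      (MvPolynomial.X i)
      ((MvPolynomial.mem_homogeneousSubmodule _ _).2 (by simpa using MvPolynomial.isHomogeneous_X k i)))

end Plane

/-! ### Towers of blowups of the plane -/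

/-- A sequence of morphisms `⋯ ⟶ X 2 ⟶ X 1 ⟶ X 0`, where `X 0` is the projective plane, with a
point `p n` on each `X n`. What makes it a tower of blowups is `BlowupTower.IsAdmissible`. -/
structure BlowupTower (k : Type u) [Field k] where
  X : ℕ → Scheme.{u}
  base : X 0 ≅ Plane k
  π : ∀ n, X (n + 1) ⟶ X n
  p : ∀ n, X n

namespace BlowupTower

variable {k : Type u} [Field k] (T : BlowupTower k)

/-- The ideal sheaf of the reduced closed subscheme `{p n}` of `X n`. -/
def center (n : ℕ) : (T.X n).IdealSheafData :=
  Scheme.IdealSheafData.vanishingIdeal ⟨closure {T.p n}, isClosed_closure⟩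

/-- The composite morphism from `X n` to the plane. -/
def toPlane : ∀ n, T.X n ⟶ Plane k
  | 0 => T.base.hom
  | n + 1 => T.π n ≫ toPlane n

/-- The curves on `X n`: `T.curve 0 n` is the strict transform of the line `L = (Y = 0)`, and
for `1 ≤ i ≤ n`, `T.curve i n` is the strict transform of the exceptional curve `E_i`, the
preimage in `X i` of the point `p (i - 1)`. (It is empty for `i > n`.) -/
def curve (i : ℕ) : ∀ n, Set (T.X n)
  | 0 => if i = 0 then T.base.hom ⁻¹' (coordLine k 1 : Set (Plane k)) else ∅
  | n + 1 => if i = n + 1 then T.π n ⁻¹' {T.p n} else closure (T.π n ⁻¹' (curve i n \ {T.p n}))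

/-- The ideal sheaf on `X n` of the pullback of the exceptional divisor `E_i ⊆ X i`, for
`1 ≤ i ≤ n`; for `i = n` it is that of `E_n` itself. (It is `⊤` otherwise.) -/
def pullbackE (i : ℕ) : ∀ n, (T.X n).IdealSheafData
  | 0 => ⊤
  | n + 1 => if i = n + 1 then (T.center n).comap (T.π n) else (pullbackE i n).comap (T.π n)

/-- The first `N` steps of the tower are blowups at points, the first of them at `[1 : 0 : 1]`,
and each later one, `X (n + 1) ⟶ X n`, at an intersection point of two of the curves
`L, E_1, …, E_n` (strict transforms) on `X n`. Nothing is required beyond `X N`. -/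
structure IsAdmissible (N : ℕ) : Prop where
  first_center : (T.base.hom (T.p 0)).asHomogeneousIdeal.toIdeal =
    Ideal.span {(MvPolynomial.X 1 : MvPolynomial (Fin 3) k), MvPolynomial.X 0 - MvPolynomial.X 2}
  isClosed_center : ∀ n < N, IsClosed {T.p n}
  mem_inter : ∀ n, 1 ≤ n → n < N →
    ∃ i j, i < j ∧ j ≤ n ∧ T.p n ∈ T.curve i n ∩ T.curve j n
  isBlowup : ∀ n < N, IsBlowup (T.π n) (T.center n)

/-- The ideal sheaf `I` on `X n` is that of the largest normal crossings divisor on `X n` whose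
image in the plane lies in `Δ`. -/
def IsMaximalNormalCrossings (n : ℕ) (I : (T.X n).IdealSheafData) : Prop :=
  IsLeast {J : (T.X n).IdealSheafData | IsNormalCrossings J ∧
    T.toPlane n '' (J.support : Set (T.X n)) ⊆ ((triangle k).support : Set (Plane k))} I

/-- Near the point `p n` of `X n`, the ideal sheaf `I` is generated by the rational functions
`(x - 1) ^ b / y ^ a` and `y ^ c / (x - 1) ^ d`, which are regular there; here `x = X / Z` and
`y = Y / Z`. A fraction `s / t` is the section `f` with `f * t = s`, for a non-zero-divisor `t`. -/
def IsLocallyDefinedBy (n : ℕ) (I : (T.X n).IdealSheafData) (a b c d : ℕ) : Prop :=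
  ∃ (U : (T.X n).affineOpens) (hU : U.1 ≤ T.toPlane n ⁻¹ᵁ chartZ k), T.p n ∈ U.1 ∧
    ∃ x y f g : Γ(T.X n, U.1),
      x = ((T.toPlane n).appLE (chartZ k) U.1 hU).hom (affineCoord k 0) ∧
      y = ((T.toPlane n).appLE (chartZ k) U.1 hU).hom (affineCoord k 1) ∧
      x - 1 ∈ nonZeroDivisors Γ(T.X n, U.1) ∧ y ∈ nonZeroDivisors Γ(T.X n, U.1) ∧
      f * y ^ a = (x - 1) ^ b ∧ g * (x - 1) ^ d = y ^ c ∧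
      I.ideal U = Ideal.span {f, g}

end BlowupTower

end

/-! Everything happens over the point `[1 : 0 : 1]`, and there the tower is toric. Every exceptional
curve lies over that point. A later centre lies on two distinct curves of the tower, at least one of
them exceptional, so all centres lie over it, and outside the fibre each `X n` is the plane minus a
point.

Points of the fibre are covered by charts `Spec k[u, v]` in which `x - 1 = u ^ α 0 * v ^ α 1` and `y
= u ^ β 0 * v ^ β 1`, with `α 0 * β 1 - α 1 * β 0 = 1`, and in which each curve of the tower is
empty or an axis on which `y` vanishes (`IsMonomialChart`). Two distinct curves can meet only at the
origin, so a centre in a chart is its origin. Blowing it up gives two charts of the same kind, in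
which one column of the exponent matrix is replaced by the sum of both columns
(`IsMonomialChart.blowup`); a chart that misses the centre survives (`IsMonomialChart.lift`). Since
blowups are known only through their universal property, their charts must first be derived from it
(`IsBlowup.exists_chart`).

For (i), the reduced preimage of `Δ` is locally a sum of coordinate axes, hence has strict normal
crossings, and a reduced divisor with support over `Δ` is bounded by it. For the formula, on `X 1`
the pullback of `L` is already reduced. At every later centre both axes lie in the reduced preimage
of `L`; its pullback contains the new exceptional curve twice and the new reduced preimage contains
it once, so each step from `X n` with `n ≥ 1` subtracts one copy of the new curve
(`comap_reducedPreimage`).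

For (ii), inverting the unimodular exponent matrix gives `u = (x - 1) ^ β 1 / y ^ α 1` and `v = y ^
α 0 / (x - 1) ^ β 0`, and these generate the ideal of the origin. Adding columns forms the mediant
of `α 1 / β 1` and `α 0 / β 0`. A centre on the newest curve lies in a chart produced at the last
step, so the level of the tree advances with every blowup. -/

noncomputable section

attribute [local instance] MvPolynomial.gradedAlgebra

/-! ### Ideal sheaves as ideals in affine charts. -/

section

namespace AlgebraicGeometry.Scheme.IdealSheafData

/-- The ideal of `R` generated by the inverse image of an ideal sheaf under `Spec R ⟶ X`. -/
def pull {X : Scheme.{u}} {R : CommRingCat.{u}} (I : X.IdealSheafData) (χ : Spec R ⟶ X) : Ideal R :=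
  ((I.comap χ).ideal ⟨⊤, isAffineOpen_top _⟩).comap (Scheme.ΓSpecIso R).inv.hom

variable {X Y : Scheme.{u}} {R S : CommRingCat.{u}}

lemma bijective_ΓSpecIso_inv (R : CommRingCat.{u}) :
    Function.Bijective (Scheme.ΓSpecIso R).inv.hom :=
  (Scheme.ΓSpecIso R).symm.commRingCatIsoToRingEquiv.bijective

lemma pull_comap (I : Y.IdealSheafData) (f : X ⟶ Y) (χ : Spec R ⟶ X) :
    (I.comap f).pull χ = I.pull (χ ≫ f) := by
  simp [pull]

lemma pull_map (J : (Spec S).IdealSheafData) (φ : R ⟶ S) :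
    (J.map (Spec.map φ)).pull (𝟙 _) = (J.pull (𝟙 _)).comap φ.hom := by
  simp only [pull, comap_id]
  rw [ideal_map_of_isAffineHom, Ideal.comap_comap, Ideal.comap_comap]
  have := Scheme.ΓSpecIso_inv_naturality φ
  rw [← CommRingCat.hom_comp, ← CommRingCat.hom_comp, this]
  rfl

lemma pull_id_le_iff {I J : (Spec R).IdealSheafData} :
    I.pull (𝟙 _) ≤ J.pull (𝟙 _) ↔ I ≤ J := by
  simp only [pull, comap_id]
  rw [Ideal.comap_le_comap_iff_of_surjective _ (bijective_ΓSpecIso_inv R).2]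
  exact ⟨fun h ↦ le_of_isAffine h, fun h ↦ h _⟩

lemma pull_id_surjective (a : Ideal R) : ∃ I : (Spec R).IdealSheafData, I.pull (𝟙 _) = a := by
  refine ⟨equivOfIsAffine.symm (a.map (Scheme.ΓSpecIso R).inv.hom), ?_⟩
  have h : (equivOfIsAffine.symm (a.map (Scheme.ΓSpecIso R).inv.hom)).ideal
      ⟨⊤, isAffineOpen_top _⟩ = a.map (Scheme.ΓSpecIso R).inv.hom :=
    equivOfIsAffine.apply_symm_apply _
  simp only [pull, comap_id, h]
  exact Ideal.comap_map_of_bijective _ (bijective_ΓSpecIso_inv R)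

/-- Extension of ideals and inverse image of ideal sheaves are left adjoints, so it suffices to
compare the right adjoints, which is `pull_map`; every ideal of `S` is available for the test by
`pull_id_surjective`. -/
lemma pull_specMap (I : X.IdealSheafData) (χ : Spec R ⟶ X) (φ : R ⟶ S) :
    I.pull (Spec.map φ ≫ χ) = (I.pull χ).map φ.hom := by
  have key (J : (Spec R).IdealSheafData) :
      (J.comap (Spec.map φ)).pull (𝟙 _) = (J.pull (𝟙 _)).map φ.hom := by
    refine eq_of_forall_ge_iff fun a ↦ ?_
    obtain ⟨K, rfl⟩ := pull_id_surjective a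
    rw [Ideal.map_le_iff_le_comap, ← pull_map, pull_id_le_iff, pull_id_le_iff,
      le_map_iff_comap_le]
  have := key (I.comap χ)
  rw [← comap_comp] at this
  simpa [pull] using this

lemma pull_fromSpec (I : X.IdealSheafData) {U : X.Opens} (hU : IsAffineOpen U) :
    I.pull hU.fromSpec = I.ideal ⟨U, hU⟩ := by
  have h1 : hU.fromSpec ''ᵁ ⊤ ≤ U := by
    rw [Scheme.Hom.image_top_eq_opensRange, hU.opensRange_fromSpec]
  have h2 : (Scheme.ΓSpecIso Γ(X, U)).inv ≫ (hU.fromSpec.appIso ⊤).inv =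
      X.presheaf.map (homOfLE h1).op := by
    have e : ⊤ ≤ hU.fromSpec ⁻¹ᵁ U := by rw [hU.fromSpec_preimage_self]
    have h3 : hU.fromSpec.appLE U ⊤ e = (Scheme.ΓSpecIso Γ(X, U)).inv := by
      rw [Scheme.Hom.appLE, hU.fromSpec_app_self, Category.assoc, ← Functor.map_comp]
      exact (congrArg _ ((Spec Γ(X, U)).presheaf.map_id _)).trans (Category.comp_id _)
    rw [← h3, Scheme.Hom.appLE_appIso_inv]
  have h4 : Function.Bijective (X.presheaf.map (homOfLE h1).op).hom := by
    rw [← h2]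
    exact ((hU.fromSpec.appIso ⊤) ≪≫
      (Scheme.ΓSpecIso Γ(X, U))).symm.commRingCatIsoToRingEquiv.bijective
  have h5 := I.map_ideal (V := ⟨U, hU⟩)
    (U := ⟨_, (isAffineOpen_top _).image_of_isOpenImmersion hU.fromSpec⟩) h1
  rw [pull, ideal_comap_of_isOpenImmersion, Ideal.comap_comap, ← CommRingCat.hom_comp, h2]
  exact (congrArg (Ideal.comap _) h5.symm).trans (Ideal.comap_map_of_bijective _ h4)

/-- The sections over the image of an affine scheme under an open immersion. -/
def sectionsIso (χ : Spec R ⟶ X) [IsOpenImmersion χ] : Γ(X, χ.opensRange) ≅ R :=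
  (IsOpenImmersion.ΓIsoTop χ).symm ≪≫ Scheme.ΓSpecIso R

lemma sectionsIso_hom (χ : Spec R ⟶ X) [IsOpenImmersion χ] :
    (sectionsIso χ).hom = χ.appLE χ.opensRange ⊤ (by simp) ≫ (Scheme.ΓSpecIso R).hom := by
  simp [sectionsIso, IsOpenImmersion.ΓIsoTop, Scheme.Hom.appIso_hom']

lemma specMap_sectionsIso_fromSpec (χ : Spec R ⟶ X) [IsOpenImmersion χ] :
    Spec.map (sectionsIso χ).hom ≫ (isAffineOpen_opensRange χ).fromSpec = χ := by
  rw [sectionsIso_hom, Spec.map_comp, Category.assoc,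
    IsAffineOpen.SpecMap_appLE_fromSpec _ _ (isAffineOpen_top _), IsAffineOpen.fromSpec_top]
  simp [Scheme.isoSpec_Spec_inv]

lemma pull_eq_map (I : X.IdealSheafData) (χ : Spec R ⟶ X) [IsOpenImmersion χ] :
    I.pull χ = (I.ideal ⟨_, isAffineOpen_opensRange χ⟩).map (sectionsIso χ).hom.hom := by
  conv_lhs => rw [← specMap_sectionsIso_fromSpec χ]
  rw [pull_specMap, pull_fromSpec]

lemma ideal_eq_comap (I : X.IdealSheafData) (χ : Spec R ⟶ X) [IsOpenImmersion χ] :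
    I.ideal ⟨_, isAffineOpen_opensRange χ⟩ = (I.pull χ).comap (sectionsIso χ).hom.hom := by
  rw [pull_eq_map]
  exact (Ideal.comap_map_of_bijective _
    (sectionsIso χ).commRingCatIsoToRingEquiv.bijective).symm

/-- Every point has an affine neighbourhood whose image under `f` lies in an affine open set. -/
lemma exists_specMap_comp (f : X ⟶ Y) (x : X) : ∃ (R S : CommRingCat.{u}) (χ : Spec S ⟶ X)
    (η : Spec R ⟶ Y) (φ : R ⟶ S), IsOpenImmersion χ ∧ IsOpenImmersion η ∧ x ∈ Set.range χ ∧
      χ ≫ f = Spec.map φ ≫ η := by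
  obtain ⟨_, ⟨U, (hU : IsAffineOpen U), rfl⟩, hxU, -⟩ :=
    Y.isBasis_affineOpens.exists_subset_of_mem_open (Set.mem_univ (f x)) isOpen_univ
  obtain ⟨_, ⟨V, (hV : IsAffineOpen V), rfl⟩, hxV, hVU⟩ :=
    X.isBasis_affineOpens.exists_subset_of_mem_open (show x ∈ (f ⁻¹ᵁ U : Set X) from hxU)
      (f ⁻¹ᵁ U).isOpen
  exact ⟨_, _, IsAffineOpen.fromSpec hV, IsAffineOpen.fromSpec hU, f.appLE U V hVU, inferInstance,
    inferInstance, by rw [IsAffineOpen.range_fromSpec]; exact hxV,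
    (IsAffineOpen.SpecMap_appLE_fromSpec _ _ _ _).symm⟩

lemma le_of_pull_le {I J : X.IdealSheafData} (h : ∀ x : X, ∃ (R : CommRingCat.{u})
    (χ : Spec R ⟶ X), IsOpenImmersion χ ∧ x ∈ Set.range χ ∧ I.pull χ ≤ J.pull χ) : I ≤ J := by
  choose R χ hχ hx hIJ using h
  refine le_of_iSup_eq_top (fun x ↦ ⟨(χ x).opensRange, isAffineOpen_opensRange (χ x)⟩) ?_ ?_
  · exact top_le_iff.1 fun x _ ↦ Opens.mem_iSup.2 ⟨x, hx x⟩
  · intro x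
    rw [ideal_eq_comap, ideal_eq_comap]
    exact Ideal.comap_mono (hIJ x)

lemma ext_of_pull {I J : X.IdealSheafData} (h : ∀ x : X, ∃ (R : CommRingCat.{u})
    (χ : Spec R ⟶ X), IsOpenImmersion χ ∧ x ∈ Set.range χ ∧ I.pull χ = J.pull χ) : I = J := by
  refine le_antisymm (le_of_pull_le fun x ↦ ?_) (le_of_pull_le fun x ↦ ?_)
  · obtain ⟨R, χ, h1, h2, h3⟩ := h x
    exact ⟨R, χ, h1, h2, h3.le⟩
  · obtain ⟨R, χ, h1, h2, h3⟩ := h x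
    exact ⟨R, χ, h1, h2, h3.ge⟩

lemma ext_of_comap {I J : X.IdealSheafData} (h : ∀ x : X, ∃ (Y : Scheme.{u})
    (g : Y ⟶ X), IsOpenImmersion g ∧ x ∈ Set.range g ∧ I.comap g = J.comap g) : I = J := by
  refine ext_of_pull fun x ↦ ?_
  obtain ⟨Y, g, h1, ⟨y, rfl⟩, h3⟩ := h x
  obtain ⟨R, S, χ, η, φ, hχ, -, ⟨z, rfl⟩, -⟩ := exists_specMap_comp (𝟙 Y) y
  exact ⟨S, χ ≫ g, inferInstance, ⟨z, by simp⟩, by rw [← pull_comap, h3, pull_comap]⟩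

lemma pull_mul_of_isOpenImmersion (I J : X.IdealSheafData) (χ : Spec R ⟶ X) [IsOpenImmersion χ] :
    (I * J).pull χ = I.pull χ * J.pull χ := by
  simp only [pull_eq_map, ideal_mul, Pi.mul_apply, Ideal.map_mul]

/-- Locally `f` is a map of affine schemes, where the inverse image is extension of ideals, and
extension is multiplicative. -/
lemma comap_mul (I J : Y.IdealSheafData) (f : X ⟶ Y) :
    (I * J).comap f = I.comap f * J.comap f := by
  refine ext_of_pull fun x ↦ ?_
  obtain ⟨R, S, χ, η, φ, hχ, hη, hx, e⟩ := exists_specMap_comp f x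
  refine ⟨S, χ, hχ, hx, ?_⟩
  simp only [pull_mul_of_isOpenImmersion, pull_comap, e, pull_specMap, Ideal.map_mul]

lemma pull_mul (I J : X.IdealSheafData) (χ : Spec R ⟶ X) :
    (I * J).pull χ = I.pull χ * J.pull χ := by
  have := pull_mul_of_isOpenImmersion (I.comap χ) (J.comap χ) (𝟙 _)
  rw [← comap_mul] at this
  simpa only [pull_comap, Category.id_comp] using this

lemma comap_prod {ι : Type*} (s : Finset ι) (I : ι → Y.IdealSheafData) (f : X ⟶ Y) :
    (∏ i ∈ s, I i).comap f = ∏ i ∈ s, (I i).comap f := by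
  classical
  induction s using Finset.induction_on with
  | empty => simp
  | insert a s ha ih => rw [Finset.prod_insert ha, Finset.prod_insert ha, comap_mul, ih]

lemma pull_top (χ : Spec R ⟶ X) : (⊤ : X.IdealSheafData).pull χ = ⊤ := by
  simp [pull]

lemma pull_radical (I : X.IdealSheafData) (χ : Spec R ⟶ X) [IsOpenImmersion χ] :
    I.radical.pull χ = (I.pull χ).radical := by
  have key (a : Ideal Γ(X, χ.opensRange)) : a.map (sectionsIso χ).hom.hom =
      a.comap (sectionsIso χ).inv.hom :=
    Ideal.map_comap_of_equiv (sectionsIso χ).commRingCatIsoToRingEquiv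
  rw [pull_eq_map, pull_eq_map, key, key, radical_ideal, Ideal.comap_radical]

lemma comap_radical (I : Y.IdealSheafData) (f : X ⟶ Y) [IsOpenImmersion f] :
    I.radical.comap f = (I.comap f).radical := by
  refine ext_of_pull fun x ↦ ?_
  obtain ⟨R, S, χ, η, φ, hχ, -, hx, -⟩ := exists_specMap_comp f x
  refine ⟨S, χ, hχ, hx, ?_⟩
  rw [pull_radical, pull_comap, pull_comap, pull_radical]

lemma mem_support_iff_pull_le (I : X.IdealSheafData) (χ : Spec R ⟶ X) (q : Spec R) :
    χ q ∈ I.support ↔ I.pull χ ≤ q.asIdeal := by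
  have h : χ q ∈ I.support ↔ q ∈ (I.comap χ).support := by
    rw [support_comap]; rfl
  rw [h, mem_support_iff_of_mem (U := ⟨⊤, isAffineOpen_top _⟩) (show q ∈ ⊤ from trivial),
    Scheme.mem_zeroLocus_iff]
  have h2 (r : R) : q ∈ (Spec R).basicOpen ((Scheme.ΓSpecIso R).inv r) ↔ r ∉ q.asIdeal := by
    rw [basicOpen_eq_of_affine]; rfl
  constructor
  · intro H r hr
    by_contra h3
    exact H _ hr ((h2 r).2 h3)
  · intro H g hg hq
    obtain ⟨r, rfl⟩ := (bijective_ΓSpecIso_inv R).2 g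
    exact (h2 r).1 hq (H hg)

lemma radical_vanishingIdeal (Z : Closeds X) : (vanishingIdeal Z).radical = vanishingIdeal Z := by
  rw [← vanishingIdeal_support]
  congr 1

/-- A vanishing ideal is radical, also in the chart, and a radical ideal is the intersection of the
primes that contain it. -/
lemma mem_pull_vanishingIdeal_iff (Z : Closeds X) (χ : Spec R ⟶ X) [IsOpenImmersion χ] (r : R) :
    r ∈ (vanishingIdeal Z).pull χ ↔ ∀ q : Spec R, χ q ∈ Z → r ∈ q.asIdeal := by
  have h2 := pull_radical (vanishingIdeal Z) χ
  rw [radical_vanishingIdeal] at h2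
  rw [h2, ← PrimeSpectrum.vanishingIdeal_zeroLocus_eq_radical, PrimeSpectrum.mem_vanishingIdeal]
  refine forall_congr' fun q ↦ ?_
  rw [PrimeSpectrum.mem_zeroLocus, SetLike.coe_subset_coe]
  have := mem_support_iff_pull_le (vanishingIdeal Z) χ q
  rw [← this, ← SetLike.mem_coe, coe_support_vanishingIdeal]
  rfl

end AlgebraicGeometry.Scheme.IdealSheafData

end

/-! ### Cartier divisors, principal open subcharts and regular parameters in charts. -/

section

namespace AlgebraicGeometry.Scheme.IdealSheafData

variable {X Y : Scheme.{u}} {R S : CommRingCat.{u}}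

instance isPrime_asIdeal (q : Spec R) : q.asIdeal.IsPrime := PrimeSpectrum.isPrime q

lemma isEffectiveCartier_of_pull {I : X.IdealSheafData} (h : ∀ x : X, ∃ (R : CommRingCat.{u})
    (χ : Spec R ⟶ X), IsOpenImmersion χ ∧ x ∈ Set.range χ ∧
      ∃ f ∈ nonZeroDivisors R, I.pull χ = Ideal.span {f}) : IsEffectiveCartier I := by
  intro x
  obtain ⟨R, χ, hχ, hx, f, hf, e⟩ := h x
  refine ⟨⟨_, isAffineOpen_opensRange χ⟩, hx, (sectionsIso χ).inv f, ?_, ?_⟩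
  · exact (MulEquivClass.map_nonZeroDivisors
      (sectionsIso χ).symm.commRingCatIsoToRingEquiv).le (Submonoid.mem_map_of_mem _ hf)
  · rw [ideal_eq_comap, e]
    have := Ideal.map_comap_of_equiv (I := Ideal.span {f})
      (sectionsIso χ).symm.commRingCatIsoToRingEquiv
    refine this.symm.trans ?_
    rw [Ideal.map_span, Set.image_singleton]
    rfl

lemma _root_.IsEffectiveCartier.exists_pull {I : X.IdealSheafData} (h : IsEffectiveCartier I)
    (x : X) : ∃ (R : CommRingCat.{u}) (χ : Spec R ⟶ X), IsOpenImmersion χ ∧ x ∈ Set.range χ ∧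
      ∃ f ∈ nonZeroDivisors R, I.pull χ = Ideal.span {f} := by
  obtain ⟨⟨U, (hU : IsAffineOpen U)⟩, hx, f, hf, e⟩ := h x
  refine ⟨_, hU.fromSpec, inferInstance, ?_, f, hf, ?_⟩
  · rw [IsAffineOpen.range_fromSpec]; exact hx
  · rw [pull_fromSpec, e]

lemma isEffectiveCartier_top : IsEffectiveCartier (⊤ : X.IdealSheafData) := by
  refine isEffectiveCartier_of_pull fun x ↦ ?_
  obtain ⟨R, S, χ, η, φ, hχ, -, hx, -⟩ := exists_specMap_comp (𝟙 X) x
  exact ⟨S, χ, hχ, hx, 1, one_mem _, by simp [pull_top]⟩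

/-- The principal open subset of the image of `χ` on which `r` does not vanish. -/
def shrink (χ : Spec R ⟶ X) (r : R) : Spec (CommRingCat.of (Localization.Away r)) ⟶ X :=
  Spec.map (CommRingCat.ofHom (algebraMap R (Localization.Away r))) ≫ χ

instance (χ : Spec R ⟶ X) [IsOpenImmersion χ] (r : R) : IsOpenImmersion (shrink χ r) := by
  have : IsOpenImmersion (Spec.map (CommRingCat.ofHom (algebraMap R (Localization.Away r)))) :=
    inferInstance
  delta shrink; infer_instance

lemma pull_shrink (I : X.IdealSheafData) (χ : Spec R ⟶ X) (r : R) :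
    I.pull (shrink χ r) = (I.pull χ).map (algebraMap R (Localization.Away r)) :=
  pull_specMap ..

lemma range_shrink (χ : Spec R ⟶ X) (r : R) :
    Set.range (shrink χ r) = χ '' {q : Spec R | r ∉ q.asIdeal} := by
  have h : Set.range (Spec.map (CommRingCat.ofHom (algebraMap R (Localization.Away r)))) =
      {q : Spec R | r ∉ q.asIdeal} :=
    PrimeSpectrum.localization_away_comap_range (Localization.Away r) r
  rw [shrink, Scheme.Hom.comp_base, TopCat.coe_comp, Set.range_comp, h]

lemma mem_range_shrink (χ : Spec R ⟶ X) (r : R) (q : Spec R) (h : r ∉ q.asIdeal) :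
    χ q ∈ Set.range (shrink χ r) := by
  rw [range_shrink]; exact ⟨q, h, rfl⟩

lemma exists_shrink (χ : Spec R ⟶ X) (q : Spec R) (U : X.Opens) (hU : χ q ∈ U) :
    ∃ r : R, r ∉ q.asIdeal ∧ Set.range (shrink χ r) ⊆ U := by
  obtain ⟨_, ⟨r, rfl⟩, h1, h2⟩ :=
    PrimeSpectrum.isTopologicalBasis_basic_opens.exists_subset_of_mem_open
    (show q ∈ (χ ⁻¹ᵁ U : Set (Spec R)) from hU) (χ ⁻¹ᵁ U).isOpen
  refine ⟨r, h1, ?_⟩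
  rw [range_shrink]
  rintro _ ⟨q', hq', rfl⟩
  exact h2 hq'

/-- The stalk is a localization of the sections over the image of `χ`; the algebra structure over
`R` is obtained by transport along `sectionsIso χ`. -/
lemma isLocalization_atPrime_stalk (χ : Spec R ⟶ X) [IsOpenImmersion χ] (q : Spec R) :
    let := ((sectionsIso χ).inv ≫ X.presheaf.germ χ.opensRange (χ q) ⟨q, rfl⟩).hom.toAlgebra
    IsLocalization.AtPrime (X.presheaf.stalk (χ q)) q.asIdeal := by
  let U := χ.opensRange
  let hU := isAffineOpen_opensRange χ
  let x : U := ⟨χ q, q, rfl⟩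
  let alg := X.presheaf.algebra_section_stalk x
  have h1 : hU.primeIdealOf x = Spec.map (sectionsIso χ).hom q := by
    apply hU.fromSpec.isOpenEmbedding.injective
    rw [IsAffineOpen.fromSpec_primeIdealOf, ← Scheme.Hom.comp_apply, specMap_sectionsIso_fromSpec]
  have h2 := hU.isLocalization_stalk x
  rw [h1] at h2
  have h3 := IsLocalization.isLocalization_of_base_ringEquiv
    (M := (Spec.map (sectionsIso χ).hom q).asIdeal.primeCompl)
    (S := X.presheaf.stalk (χ q)) (sectionsIso χ).commRingCatIsoToRingEquiv
  have h4 : (Spec.map (sectionsIso χ).hom q).asIdeal.primeCompl.map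
      (sectionsIso χ).commRingCatIsoToRingEquiv = q.asIdeal.primeCompl := by
    ext r
    constructor
    · rintro ⟨a, ha, rfl⟩
      exact ha
    · intro hr
      obtain ⟨a, rfl⟩ := (sectionsIso χ).commRingCatIsoToRingEquiv.surjective r
      exact ⟨a, hr, rfl⟩
  rw [h4] at h3
  exact h3

/-- Reduces strict normal crossings at a point to generators of a prime ideal in the ring of a
chart. The factor `w` becomes a unit in the stalk, so `f` need only be a product of parameters up to
functions that do not vanish at `q`. -/
lemma exists_regular_parameters_of_pull {I : X.IdealSheafData} (χ : Spec R ⟶ X)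
    [IsOpenImmersion χ] (q : Spec R) [IsRegularRing R] {f : R} (hI : I.pull χ = Ideal.span {f})
    {d : ℕ} (t : Fin d → R) (s : Finset (Fin d)) (hd : q.asIdeal.height = d)
    (ht : Ideal.span (Set.range t) = q.asIdeal) {w : R} (hw : w ∉ q.asIdeal)
    (hf : f = w * ∏ i ∈ s, t i) :
    IsRegularLocalRing (X.presheaf.stalk (χ q)) ∧
    ∃ (d : ℕ) (t : Fin d → X.presheaf.stalk (χ q)) (s : Finset (Fin d)),
      ringKrullDim (X.presheaf.stalk (χ q)) = d ∧
      Ideal.span (Set.range t) = IsLocalRing.maximalIdeal (X.presheaf.stalk (χ q)) ∧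
      ∃ (U : X.affineOpens) (hx : χ q ∈ U.1),
        (I.ideal U).map (X.presheaf.germ U.1 (χ q) hx).hom = Ideal.span {∏ i ∈ s, t i} := by
  let := ((sectionsIso χ).inv ≫ X.presheaf.germ χ.opensRange (χ q) ⟨q, rfl⟩).hom.toAlgebra
  have hloc : IsLocalization.AtPrime (X.presheaf.stalk (χ q)) q.asIdeal :=
    isLocalization_atPrime_stalk χ q
  have hreg : IsRegularLocalRing (Localization.AtPrime q.asIdeal) := inferInstance
  refine ⟨IsRegularLocalRing.of_ringEquiv (IsLocalization.algEquiv q.asIdeal.primeCompl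
    (Localization.AtPrime q.asIdeal) (X.presheaf.stalk (χ q))).toRingEquiv, d,
    fun i ↦ algebraMap R _ (t i), s, ?_, ?_, ⟨_, isAffineOpen_opensRange χ⟩, ⟨q, rfl⟩, ?_⟩
  · rw [IsLocalization.AtPrime.ringKrullDim_eq_height q.asIdeal, hd]; rfl
  · rw [← IsLocalization.AtPrime.map_eq_maximalIdeal q.asIdeal, ← ht, Ideal.map_span]
    congr 1
    ext; simp
  · have h1 : (I.ideal ⟨_, isAffineOpen_opensRange χ⟩).map
        (X.presheaf.germ χ.opensRange (χ q) ⟨q, rfl⟩).hom =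
        (I.pull χ).map (algebraMap R (X.presheaf.stalk (χ q))) := by
      have h2 : algebraMap R (X.presheaf.stalk (χ q)) =
          ((sectionsIso χ).inv ≫ X.presheaf.germ χ.opensRange (χ q) ⟨q, rfl⟩).hom := rfl
      rw [h2, pull_eq_map, Ideal.map_map, ← CommRingCat.hom_comp, Iso.hom_inv_id_assoc]
    refine h1.trans ?_
    rw [hI, Ideal.map_span, Set.image_singleton, hf, map_mul, map_prod]
    refine Ideal.span_singleton_mul_left_unit ?_ _
    exact IsLocalization.map_units (M := q.asIdeal.primeCompl) _ ⟨w, hw⟩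

end AlgebraicGeometry.Scheme.IdealSheafData

end

/-! ### Charts of a blowup, from its universal property. -/

section

open Limits AlgebraicGeometry.Scheme.IdealSheafData

namespace AlgebraicGeometry

variable {P : Scheme.{u}} {A B : CommRingCat.{u}}

/-- The ring homomorphism to the global sections that corresponds to a morphism to `Spec A`. -/
def globalSectionsHom (f : P ⟶ Spec A) : A ⟶ Γ(P, ⊤) := (Scheme.ΓSpecIso A).inv ≫ f.appTop

lemma globalSectionsHom_comp_specMap (f : P ⟶ Spec B) (φ : A ⟶ B) :
    globalSectionsHom (f ≫ Spec.map φ) = φ ≫ globalSectionsHom f := by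
  simp [globalSectionsHom]

lemma globalSectionsHom_injective {f g : P ⟶ Spec A}
    (h : globalSectionsHom f = globalSectionsHom g) : f = g :=
  ext_of_isAffine ((cancel_epi _).1 h)

lemma notMem_of_isUnit_globalSectionsHom (f : P ⟶ Spec A) (a : A)
    (h : IsUnit (globalSectionsHom f a)) (z : P) : a ∉ (f z).asIdeal := by
  have h1 : f ⁻¹ᵁ (Spec A).basicOpen ((Scheme.ΓSpecIso A).inv a) = ⊤ := by
    rw [Scheme.preimage_basicOpen]
    exact P.basicOpen_of_isUnit h
  rw [basicOpen_eq_of_affine] at h1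
  exact h1.ge (show z ∈ ⊤ from trivial)

/-- A nonempty open subscheme of an integral scheme is integral, and restriction to it is injective.
If `P` is empty, its ring of sections is zero and every element is a nonzerodivisor. -/
lemma globalSectionsHom_mem_nonZeroDivisors [IsDomain A] (f : P ⟶ Spec A) [IsOpenImmersion f]
    {a : A} (ha : a ≠ 0) : globalSectionsHom f a ∈ nonZeroDivisors Γ(P, ⊤) := by
  cases isEmpty_or_nonempty P with
  | inl h =>
    have : Subsingleton Γ(P, ⊤) := by
      rw [show (⊤ : P.Opens) = ⊥ from Subsingleton.elim _ _]; infer_instance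
    exact ⟨fun _ _ ↦ Subsingleton.elim _ _, fun _ _ ↦ Subsingleton.elim _ _⟩
  | inr h =>
    have := isIntegral_of_isOpenImmersion f
    refine mem_nonZeroDivisors_of_ne_zero fun h0 ↦ ha ?_
    have e : f.appTop = (Spec A).presheaf.map (homOfLE (le_top : f ''ᵁ ⊤ ≤ ⊤)).op ≫
        (f.appIso ⊤).hom := by
      rw [Scheme.Hom.appIso_hom', Scheme.Hom.map_appLE, Scheme.Hom.appTop,
        Scheme.Hom.app_eq_appLE]
      rfl
    have : Nonempty (f ''ᵁ ⊤ : (Spec A).Opens) := by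
      obtain ⟨z⟩ := h
      exact ⟨f z, z, trivial, rfl⟩
    have h1 := map_injective_of_isIntegral (Spec A) (homOfLE (le_top : f ''ᵁ ⊤ ≤ ⊤))
    have h2 : Function.Injective (globalSectionsHom f).hom := by
      rw [globalSectionsHom, e]
      exact ((f.appIso ⊤).commRingCatIsoToRingEquiv.injective.comp h1).comp
        (Scheme.ΓSpecIso A).symm.commRingCatIsoToRingEquiv.injective
    exact h2 (h0.trans (map_zero _).symm)

end AlgebraicGeometry

namespace IsBlowup

variable {X' X : Scheme.{u}} {π : X' ⟶ X} {I : X.IdealSheafData}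

lemma hom_ext (h : IsBlowup π I) {Y : Scheme.{u}} {f g : Y ⟶ X'}
    (hf : IsEffectiveCartier (I.comap (f ≫ π))) (e : f ≫ π = g ≫ π) : f = g :=
  (h.existsUnique_lift Y (f ≫ π) hf).unique rfl e.symm

/-- A blowup is an isomorphism away from its centre. -/
lemma exists_lift_of_comap_eq_top (h : IsBlowup π I) {V : Scheme.{u}} (χ : V ⟶ X)
    [IsOpenImmersion χ] (hχ : I.comap χ = ⊤) :
    ∃ χ' : V ⟶ X', IsOpenImmersion χ' ∧ χ' ≫ π = χ ∧
      ∀ x, π x ∈ Set.range χ → x ∈ Set.range χ' := by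
  obtain ⟨g, hg, -⟩ := h.existsUnique_lift V χ (hχ ▸ isEffectiveCartier_top)
  -- Both morphisms have the same composite with `π`, and over `V` the inverse image of `I` is
  -- trivial, hence invertible; so the uniqueness of lifts applies, and `g` inverts the projection
  -- to `V`.
  have e : pullback.snd π χ ≫ g = pullback.fst π χ := by
    refine h.hom_ext ?_ ?_
    · rw [Category.assoc, hg, comap_comp, hχ, comap_top]
      exact isEffectiveCartier_top
    · rw [Category.assoc, hg, pullback.condition]
  have hc : g ≫ π = 𝟙 V ≫ χ := by rw [hg, Category.id_comp]
  have h1 : pullback.lift g (𝟙 V) hc ≫ pullback.snd π χ = 𝟙 V := pullback.lift_snd ..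
  have h2 : pullback.snd π χ ≫ pullback.lift g (𝟙 V) hc = 𝟙 _ := by
    apply pullback.hom_ext
    · rw [Category.assoc, pullback.lift_fst, e, Category.id_comp]
    · rw [Category.assoc, pullback.lift_snd, Category.comp_id, Category.id_comp]
  have : IsIso (pullback.snd π χ) := ⟨_, h2, h1⟩
  have e2 : g = inv (pullback.snd π χ) ≫ pullback.fst π χ := by rw [← e]; simp
  refine ⟨g, by rw [e2]; infer_instance, hg, fun x hx ↦ ?_⟩
  have h3 : x ∈ Set.range (pullback.fst π χ) := by
    rw [IsOpenImmersion.range_pullbackFst]; exact hx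
  obtain ⟨z, rfl⟩ := h3
  exact ⟨pullback.snd π χ z, by rw [← Scheme.Hom.comp_apply, e]⟩

/-- Near `x`, the inverse image of the ideal `(s, t)` is generated by the nonzerodivisor `s`. -/
def IsGeneratedNear {R : CommRingCat.{u}} (π : X' ⟶ X) (χ : Spec R ⟶ X) (s t : R) (x : X') :
    Prop :=
  ∃ (S : CommRingCat.{u}) (w : Spec S ⟶ X') (φ : R ⟶ S), IsOpenImmersion w ∧ x ∈ Set.range w ∧
    w ≫ π = Spec.map φ ≫ χ ∧ φ s ∈ nonZeroDivisors S ∧ φ s ∣ φ t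

variable {R : CommRingCat.{u}} {χ : Spec R ⟶ X} {s t : R}

/-- After `a` is inverted, `φ s` and the local generator `f` are associates, so `φ s` is itself a
nonzerodivisor and divides `φ t`. -/
lemma IsGeneratedNear.shrink {S : CommRingCat.{u}} {w : Spec S ⟶ X'}
    [IsOpenImmersion w] {φ : R ⟶ S} (e : w ≫ π = Spec.map φ ≫ χ) {f a b : S}
    (hf : f ∈ nonZeroDivisors S) (q : Spec S) (ha : a ∉ q.asIdeal)
    (hs : φ s = f * a) (ht : φ t = f * b) : IsGeneratedNear π χ s t (w q) := by
  have ha' : IsUnit (algebraMap S (Localization.Away a) a) :=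
    IsLocalization.Away.algebraMap_isUnit a
  have hf' : algebraMap S (Localization.Away a) f ∈ nonZeroDivisors (Localization.Away a) :=
    IsLocalization.map_nonZeroDivisors_le (Submonoid.powers a) _ (Submonoid.mem_map_of_mem _ hf)
  refine ⟨_, Scheme.IdealSheafData.shrink w a,
    φ ≫ CommRingCat.ofHom (algebraMap S (Localization.Away a)), inferInstance,
    mem_range_shrink w a q ha, ?_, ?_, ?_⟩
  · rw [Scheme.IdealSheafData.shrink, Category.assoc, e, Spec.map_comp, Category.assoc]
  · change algebraMap S (Localization.Away a) (φ s) ∈ _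
    rw [hs, map_mul]
    exact mul_mem hf' ha'.mem_nonZeroDivisors
  · change algebraMap S (Localization.Away a) (φ s) ∣ algebraMap S (Localization.Away a) (φ t)
    rw [hs, ht, map_mul, map_mul]
    exact mul_dvd_mul_left _ ha'.dvd

/-- Locally `(s, t) = (f)` with `s = f * a` and `t = f * b`. Cancelling `f` shows that `a` and `b`
generate the unit ideal, so at each point one of them is invertible, and the corresponding `s` or
`t` is a generator. -/
lemma isGeneratedNear_or [IsOpenImmersion χ] (h : IsBlowup π I) (hI : I.pull χ = Ideal.span {s, t})
    (x : X') (hx : π x ∈ Set.range χ) : IsGeneratedNear π χ s t x ∨ IsGeneratedNear π χ t s x := by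
  obtain ⟨S₀, w₀, hw₀, ⟨q₀, rfl⟩, f₀, hf₀, e₀⟩ := h.invertible.exists_pull x
  obtain ⟨r, hr, hrange⟩ := exists_shrink w₀ q₀ (π ⁻¹ᵁ χ.opensRange) hx
  obtain ⟨q, hq⟩ := mem_range_shrink w₀ r q₀ hr
  set w := Scheme.IdealSheafData.shrink w₀ r
  have hf : algebraMap S₀ (Localization.Away r) f₀ ∈ nonZeroDivisors (Localization.Away r) :=
    IsLocalization.map_nonZeroDivisors_le (Submonoid.powers r) _ (Submonoid.mem_map_of_mem _ hf₀)
  have hpull := pull_shrink (I.comap π) w₀ r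
  rw [e₀, Ideal.map_span, Set.image_singleton, pull_comap] at hpull
  set f := algebraMap S₀ (Localization.Away r) f₀
  have hlift : Set.range (w ≫ π) ⊆ Set.range χ := by
    rintro _ ⟨z, rfl⟩
    exact hrange ⟨z, rfl⟩
  obtain ⟨φ, hφ⟩ := Spec.map_surjective (IsOpenImmersion.lift χ (w ≫ π) hlift)
  have e : w ≫ π = Spec.map φ ≫ χ := by rw [hφ, IsOpenImmersion.lift_fac]
  have hpull' : I.pull (w ≫ π) = Ideal.span {φ s, φ t} := by
    rw [e, pull_specMap, hI, Ideal.map_span, Set.image_pair]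
  have key : Ideal.span {f} = Ideal.span {φ s, φ t} := hpull.symm.trans hpull'
  obtain ⟨a, ha⟩ := Ideal.mem_span_singleton.1 (key ▸ Ideal.subset_span (Set.mem_insert _ _) :
    φ s ∈ Ideal.span {f})
  obtain ⟨b, hb⟩ := Ideal.mem_span_singleton.1 (key ▸ Ideal.subset_span
    (Set.mem_insert_of_mem _ rfl) : φ t ∈ Ideal.span {f})
  obtain ⟨α, β, hαβ⟩ := Ideal.mem_span_pair.1 (key ▸ Ideal.mem_span_singleton_self f)
  have h1 : α * a + β * b = 1 := by
    have : f * (α * a + β * b) = f * 1 := by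
        linear_combination hαβ - α * ha - β * hb
    exact (mul_cancel_left_mem_nonZeroDivisors hf).1 this
  rw [← hq]
  by_cases hqa : a ∈ q.asIdeal
  · right
    refine IsGeneratedNear.shrink e hf q (fun hqb ↦ q.2.ne_top ?_) hb ha
    rw [Ideal.eq_top_iff_one, ← h1]
    exact add_mem (Ideal.mul_mem_left _ _ hqa) (Ideal.mul_mem_left _ _ hqb)
  · left
    exact IsGeneratedNear.shrink e hf q hqa ha hb

section Chart

variable {R' : CommRingCat.{u}} [IsDomain R'] (σ : R ⟶ R') (T : R')

/-- One of the two standard affine charts of a blowup. -/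
lemma exists_chart [IsOpenImmersion χ] (h : IsBlowup π I) (hI : I.pull χ = Ideal.span {s, t})
    (hs : σ s ≠ 0) (ht : σ t = σ s * T)
    -- `hex` and `hext` say that `R'` is obtained from `R` by freely adjoining an element `T` with
    -- `t = s * T`; with `σ s ≠ 0` and `R'` a domain, it plays the role of `R[t/s]`.
    (hex : ∀ (S : CommRingCat.{u}) (φ : R ⟶ S) (T' : S), φ t = φ s * T' →
      ∃ φ' : R' ⟶ S, σ ≫ φ' = φ ∧ φ' T = T')
    (hext : ∀ (S : CommRingCat.{u}) (f g : R' ⟶ S), σ ≫ f = σ ≫ g → f T = g T → f = g) :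
    ∃ ψ : Spec R' ⟶ X', IsOpenImmersion ψ ∧ ψ ≫ π = Spec.map σ ≫ χ ∧
      ∀ x, IsGeneratedNear π χ s t x → x ∈ Set.range ψ := by
  have span_eq {S : CommRingCat.{u}} (φ : R ⟶ S) (hdvd : φ s ∣ φ t) :
      I.pull (Spec.map φ ≫ χ) = Ideal.span {φ s} := by
    rw [pull_specMap, hI, Ideal.map_span, Set.image_pair]
    refine le_antisymm ?_ (Ideal.span_mono (by simp))
    rw [Ideal.span_le]
    rintro _ (rfl | rfl)
    · exact Ideal.mem_span_singleton_self _
    · exact Ideal.mem_span_singleton.2 hdvd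
  have cartier {S : CommRingCat.{u}} (φ : R ⟶ S) (hφ : φ s ∈ nonZeroDivisors S)
      (hdvd : φ s ∣ φ t) : IsEffectiveCartier (I.comap (Spec.map φ ≫ χ)) := by
    refine isEffectiveCartier_of_pull fun x ↦ ⟨S, 𝟙 _, inferInstance, ⟨x, rfl⟩, φ s, hφ, ?_⟩
    rw [pull_comap, Category.id_comp, span_eq φ hdvd]
  obtain ⟨ψ, hψ, -⟩ := h.existsUnique_lift _ _
    (cartier σ (mem_nonZeroDivisors_of_ne_zero hs) ⟨T, ht⟩)
  -- Where `s` generates, the quotient `t / s` exists and defines a map to `Spec R'`; uniqueness of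
  -- lifts makes it a map over `X'`.
  have section_of {S : CommRingCat.{u}} (w : Spec S ⟶ X') (φ : R ⟶ S)
      (hw : w ≫ π = Spec.map φ ≫ χ) (hφ : φ s ∈ nonZeroDivisors S) (hdvd : φ s ∣ φ t) :
      ∃ φ' : R' ⟶ S, σ ≫ φ' = φ ∧ Spec.map φ' ≫ ψ = w := by
    obtain ⟨T', hT'⟩ := hdvd
    obtain ⟨φ', hφ', -⟩ := hex S φ T' hT'
    refine ⟨φ', hφ', (h.hom_ext ?_ ?_).symm⟩
    · rw [hw]
      exact cartier φ hφ ⟨T', hT'⟩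
    · rw [hw, Category.assoc, hψ, ← hφ', Spec.map_comp, Category.assoc]
  have hrange (x : X') (hx : IsGeneratedNear π χ s t x) : x ∈ Set.range ψ := by
    obtain ⟨S, w, φ, -, ⟨z, rfl⟩, hw, hφ, hdvd⟩ := hx
    obtain ⟨φ', -, hφ'⟩ := section_of w φ hw hφ hdvd
    exact ⟨Spec.map φ' z, by rw [← Scheme.Hom.comp_apply, hφ']⟩
  have compat {S : CommRingCat.{u}} (w : Spec S ⟶ X') (φ : R ⟶ S)
      (hw : w ≫ π = Spec.map φ ≫ χ) :
      σ ≫ globalSectionsHom (pullback.fst ψ w) = φ ≫ globalSectionsHom (pullback.snd ψ w) := by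
    rw [← globalSectionsHom_comp_specMap, ← globalSectionsHom_comp_specMap]
    congr 1
    rw [← cancel_mono χ, Category.assoc, Category.assoc, ← hw, ← hψ, pullback.condition_assoc]
  have hinv {S : CommRingCat.{u}} (w : Spec S ⟶ X') (φ : R ⟶ S) [IsOpenImmersion w]
      (hw : w ≫ π = Spec.map φ ≫ χ) (hφ : φ s ∈ nonZeroDivisors S) (hdvd : φ s ∣ φ t) :
      IsIso (pullback.snd ψ w) := by
    obtain ⟨φ', hφ', hφ''⟩ := section_of w φ hw hφ hdvd
    have hc : Spec.map φ' ≫ ψ = 𝟙 _ ≫ w := by rw [hφ'', Category.id_comp]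
    -- By `hext` only the images of `T` need comparing. They agree after multiplication by the image
    -- of `s`, which is a nonzerodivisor because the fibre product is open in the integral scheme
    -- `Spec R'`.
    have h1 : pullback.snd ψ w ≫ Spec.map φ' = pullback.fst ψ w := by
      have h2 : σ ≫ globalSectionsHom (pullback.snd ψ w ≫ Spec.map φ') =
          σ ≫ globalSectionsHom (pullback.fst ψ w) := by
        rw [compat w φ hw, globalSectionsHom_comp_specMap, reassoc_of% hφ']
      have h3 (r : R) := ConcreteCategory.congr_hom h2 r
      refine globalSectionsHom_injective (hext _ _ _ h2 ?_)
      refine (mul_cancel_left_mem_nonZeroDivisors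
        (globalSectionsHom_mem_nonZeroDivisors (pullback.fst ψ w) hs)).1 ?_
      have h4 := h3 t
      simp only [CommRingCat.comp_apply, ht, map_mul] at h3 h4
      rw [h3 s] at h4
      exact h4
    refine ⟨pullback.lift (Spec.map φ') (𝟙 _) hc, ?_, pullback.lift_snd ..⟩
    apply pullback.hom_ext
    · rw [Category.assoc, pullback.lift_fst, h1, Category.id_comp]
    · rw [Category.assoc, pullback.lift_snd, Category.comp_id, Category.id_comp]
  -- The image of `ψ` lies where `s` generates. Where `t` generates, with `s = t * v`, the fibre
  -- product has `T * v = 1`, so `v` is invertible at the point and `s` generates as well.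
  have hgen (q : Spec R') : IsGeneratedNear π χ s t (ψ q) := by
    refine (h.isGeneratedNear_or hI (ψ q) ⟨Spec.map σ q, ?_⟩).elim id ?_
    · rw [← Scheme.Hom.comp_apply, ← Scheme.Hom.comp_apply, hψ]
    · rintro ⟨S, w, φ, hw, hq, hwπ, hφ, v, hv⟩
      have hz : q ∈ Set.range (pullback.fst ψ w) := by
        rw [IsOpenImmersion.range_pullbackFst]; exact hq
      obtain ⟨z, rfl⟩ := hz
      have h2 (r : R) := ConcreteCategory.congr_hom (compat w φ hwπ) r
      simp only [CommRingCat.comp_apply] at h2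
      have h3 : globalSectionsHom (pullback.fst ψ w) T * globalSectionsHom (pullback.snd ψ w) v =
          1 := by
        refine (mul_cancel_left_mem_nonZeroDivisors
          (globalSectionsHom_mem_nonZeroDivisors (pullback.fst ψ w) hs)).1 ?_
        rw [← mul_assoc, ← map_mul, ← ht, h2, ← map_mul, ← hv, ← h2, mul_one]
      have h4 := notMem_of_isUnit_globalSectionsHom (pullback.snd ψ w) v
        (IsUnit.of_mul_eq_one_right _ h3) z
      rw [← Scheme.Hom.comp_apply, pullback.condition, Scheme.Hom.comp_apply]
      exact IsGeneratedNear.shrink hwπ hφ _ h4 hv (mul_one _).symm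
  refine ⟨ψ, ?_, hψ, hrange⟩
  choose S w φ hw hx hwπ hφ hdvd using hgen
  -- The opens `w q` cover the image of `ψ`, and over each of them `ψ` is an isomorphism by `hinv`.
  refine IsZariskiLocalAtTarget.of_range_subset_iSup (P := @IsOpenImmersion)
    (fun q ↦ (w q).opensRange) ?_ fun q ↦ ?_
  · rintro _ ⟨q, rfl⟩
    exact Opens.mem_iSup.2 ⟨q, hx q⟩
  · have := hinv (w q) (φ q) (hwπ q) (hφ q) (hdvd q)
    rw [MorphismProperty.arrow_mk_iso_iff @IsOpenImmersion (morphismRestrictOpensRange ψ (w q))]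
    infer_instance

end Chart

end IsBlowup

end

/-! ### The affine plane: blowup substitution, primes on the axes, monomial divisors. -/

section

open MvPolynomial

/-- The coordinate ring of the affine plane over `k`. -/
abbrev AffinePlaneRing (k : Type u) [Field k] : CommRingCat.{u} :=
  CommRingCat.of (MvPolynomial (Fin 2) k)

section Ring

variable {k : Type u} [Field k]

lemma not_X_dvd_X {l m : Fin 2} (h : l ≠ m) : ¬ (X l : MvPolynomial (Fin 2) k) ∣ X m := by
  rw [X_dvd_X (R := k)]
  exact h

/-- Substitution of the coordinates of a chart of the blowup of the plane at the origin. -/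
def blowupHom (k : Type u) [Field k] (l : Fin 2) :
    MvPolynomial (Fin 2) k →ₐ[k] MvPolynomial (Fin 2) k :=
  aeval fun j ↦ if j = l then X l else X l * X j

lemma blowupHom_X_self (l : Fin 2) : blowupHom k l (X l) = X l := by simp [blowupHom]

lemma blowupHom_X_of_ne {l m : Fin 2} (h : l ≠ m) : blowupHom k l (X m) = X l * X m := by
  simp [blowupHom, h.symm]

lemma eq_or_eq_of_ne {l m : Fin 2} (h : l ≠ m) (j : Fin 2) : j = l ∨ j = m := by
  revert l m j; decide

lemma fin_two_ne_cases {l m : Fin 2} (h : l ≠ m) : (l = 0 ∧ m = 1) ∨ (l = 1 ∧ m = 0) := by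
  revert l m; decide

/-- With `ringHom_ext_blowupHom` this is the universal property of `k[X l, X m][X m / X l]`, in the
form that `IsBlowup.exists_chart` requires. -/
lemma exists_ringHom_factor {S : Type*} [CommRing S] {l m : Fin 2} (h : l ≠ m)
    (φ : MvPolynomial (Fin 2) k →+* S) (T : S) (hT : φ (X m) = φ (X l) * T) :
    ∃ φ' : MvPolynomial (Fin 2) k →+* S,
      φ'.comp (blowupHom k l).toRingHom = φ ∧ φ' (X m) = T := by
  refine ⟨eval₂Hom (φ.comp C) fun j ↦ if j = l then φ (X l) else T, ?_, ?_⟩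
  · refine MvPolynomial.ringHom_ext (fun r ↦ ?_) fun j ↦ ?_
    · simp [blowupHom, algebraMap_eq]
    · rcases eq_or_eq_of_ne h j with rfl | rfl
      · simp [blowupHom]
      · simp [blowupHom, h.symm, hT]
  · simp [h.symm]

lemma ringHom_ext_blowupHom {S : Type*} [CommRing S] {l m : Fin 2} (h : l ≠ m)
    (f g : MvPolynomial (Fin 2) k →+* S) (e : f.comp (blowupHom k l).toRingHom =
      g.comp (blowupHom k l).toRingHom) (hm : f (X m) = g (X m)) : f = g := by
  have h1 (r) : f (blowupHom k l r) = g (blowupHom k l r) := DFunLike.congr_fun e r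
  refine MvPolynomial.ringHom_ext (fun r ↦ ?_) fun j ↦ ?_
  · simpa [blowupHom, algebraMap_eq] using h1 (C r)
  · rcases eq_or_eq_of_ne h j with rfl | rfl
    · simpa [blowupHom] using h1 (X j)
    · exact hm

/-- Restriction of polynomial functions to a coordinate axis. -/
def restrictAxis (k : Type u) [Field k] (l : Fin 2) : MvPolynomial (Fin 2) k →+* Polynomial k :=
  eval₂Hom Polynomial.C fun j ↦ if j = l then 0 else Polynomial.X

lemma restrictAxis_section {l m : Fin 2} (h : l ≠ m) (f : Polynomial k) :
    restrictAxis k l (Polynomial.aeval (X m : MvPolynomial (Fin 2) k) f) = f := by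
  have : ((restrictAxis k l).comp (Polynomial.aeval (X m : MvPolynomial (Fin 2) k)).toRingHom) =
      RingHom.id _ := by
    refine Polynomial.ringHom_ext (fun r ↦ ?_) ?_
    · simp [restrictAxis, algebraMap_eq]
    · simp [restrictAxis, h.symm]
  exact DFunLike.congr_fun this f

lemma sub_restrictAxis_mem {l m : Fin 2} (h : l ≠ m) (f : MvPolynomial (Fin 2) k) :
    f - Polynomial.aeval (X m : MvPolynomial (Fin 2) k) (restrictAxis k l f) ∈
      Ideal.span {(X l : MvPolynomial (Fin 2) k)} := by
  rw [← Ideal.Quotient.eq]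
  have : Ideal.Quotient.mk (Ideal.span {(X l : MvPolynomial (Fin 2) k)}) =
      ((Ideal.Quotient.mk (Ideal.span {(X l : MvPolynomial (Fin 2) k)})).comp
      (Polynomial.aeval (X m : MvPolynomial (Fin 2) k)).toRingHom).comp (restrictAxis k l) := by
    refine MvPolynomial.ringHom_ext (fun r ↦ ?_) fun j ↦ ?_
    · simp [restrictAxis, algebraMap_eq]
    · rcases eq_or_eq_of_ne h j with rfl | rfl
      · simp [restrictAxis]
      · simp [restrictAxis, h.symm]
  exact DFunLike.congr_fun this f

lemma height_span_X (l : Fin 2) :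
    (Ideal.span {(X l : MvPolynomial (Fin 2) k)}).height = 1 := by
  have hp : (Ideal.span {(X l : MvPolynomial (Fin 2) k)}).IsPrime :=
    (Ideal.span_singleton_prime (X_ne_zero l)).2 X_prime
  refine le_antisymm ?_ ?_
  · exact Ideal.height_le_one_of_isPrincipal_of_mem_minimalPrimes (Ideal.span {X l}) _
      (by rw [Ideal.minimalPrimes_eq_subsingleton_self]; rfl)
  · have hlt : (⊥ : Ideal (MvPolynomial (Fin 2) k)) < Ideal.span {X l} := by
      rw [bot_lt_iff_ne_bot, Ne, Ideal.span_singleton_eq_bot]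
      exact X_ne_zero l
    exact le_add_self.trans (Ideal.height_add_one_le_of_lt_of_isPrime hlt)

/-- Krull's height theorem gives the upper bound from two generators; the chain `0 < (X l) < q`
gives the lower bound. -/
lemma height_eq_two {q : Ideal (MvPolynomial (Fin 2) k)} [q.IsPrime] {l : Fin 2}
    {t : MvPolynomial (Fin 2) k} (hq : q = Ideal.span {X l, t})
    (ht : t ∉ Ideal.span {(X l : MvPolynomial (Fin 2) k)}) : q.height = 2 := by
  have hp : (Ideal.span {(X l : MvPolynomial (Fin 2) k)}).IsPrime :=
    (Ideal.span_singleton_prime (X_ne_zero l)).2 X_prime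
  refine le_antisymm ?_ ?_
  · refine (Ideal.height_le_card_of_mem_minimalPrimes_span (p := q) (s := {X l, t})
      (Set.toFinite _) ?_).trans ?_
    · rw [← hq, Ideal.minimalPrimes_eq_subsingleton_self]; rfl
    · have := Set.ncard_insert_le (X l : MvPolynomial (Fin 2) k) {t}
      rw [Set.ncard_singleton] at this
      exact_mod_cast this
  · have hlt : Ideal.span {(X l : MvPolynomial (Fin 2) k)} < q := by
      refine lt_of_le_of_ne (hq ▸ Ideal.span_mono (by simp)) fun h ↦ ht ?_
      rw [h, hq]
      exact Ideal.subset_span (by simp)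
    have := Ideal.height_add_one_le_of_lt_of_isPrime hlt
    rw [height_span_X] at this
    exact this

/-- Primes of the affine plane on a coordinate axis have a system of parameters that contains
the equation of the axis. -/
lemma exists_parameters_of_X_mem {q : Ideal (MvPolynomial (Fin 2) k)} [hq : q.IsPrime] {l : Fin 2}
    (hl : X l ∈ q) : ∃ (d : ℕ) (t : Fin d → MvPolynomial (Fin 2) k) (i : Fin d),
      q.height = d ∧ Ideal.span (Set.range t) = q ∧ t i = X l := by
  obtain ⟨m, hm⟩ : ∃ m, l ≠ m := exists_ne l |>.imp fun _ h ↦ h.symm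
  -- The axis has the principal ideal domain `k[X m]` as coordinate ring. Lifting a generator of the
  -- image of `q` there gives `q = (X l, t)`, of height one or two according to whether `t` lies in
  -- `(X l)`.
  obtain ⟨h, hh⟩ := (IsPrincipalIdealRing.principal (q.map (restrictAxis k l))).principal
  set t : MvPolynomial (Fin 2) k := Polynomial.aeval (X m) h
  have hle : Ideal.span {(X l : MvPolynomial (Fin 2) k)} ≤ q :=
    (Ideal.span_singleton_le_iff_mem _).2 hl
  have hsurj : Function.Surjective (restrictAxis k l) :=
    fun f ↦ ⟨_, restrictAxis_section hm f⟩
  have hq' : q = Ideal.span {X l, t} := by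
    apply le_antisymm
    · intro f hf
      obtain ⟨a, ha⟩ := Ideal.mem_span_singleton.1 (hh.le (Ideal.mem_map_of_mem _ hf))
      obtain ⟨b, hb⟩ := Ideal.mem_span_singleton.1 (sub_restrictAxis_mem hm f)
      rw [ha, map_mul] at hb
      rw [Ideal.mem_span_pair]
      exact ⟨b, Polynomial.aeval (X m) a, by linear_combination -hb⟩
    · rw [Ideal.span_le]
      rintro _ (rfl | rfl)
      · exact hl
      · have h1 : h ∈ q.map (restrictAxis k l) := hh.ge (Ideal.mem_span_singleton_self h)
        obtain ⟨f, hf, rfl⟩ := (Ideal.mem_map_iff_of_surjective _ hsurj).1 h1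
        have h2 := q.sub_mem hf (hle (sub_restrictAxis_mem hm f))
        rwa [sub_sub_cancel] at h2
  by_cases ht : t ∈ Ideal.span {(X l : MvPolynomial (Fin 2) k)}
  · have h1 : q = Ideal.span {X l} := by
      rw [hq']
      refine le_antisymm (Ideal.span_le.2 ?_) (Ideal.span_mono (by simp))
      rintro _ (rfl | rfl)
      · exact Ideal.mem_span_singleton_self _
      · exact ht
    refine ⟨1, ![X l], 0, ?_, ?_, rfl⟩
    · rw [h1, height_span_X]; rfl
    · rw [h1]; simp
  · refine ⟨2, ![X l, t], 0, height_eq_two hq' ht, ?_, rfl⟩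
    rw [hq']; simp [Set.pair_comm]

/-- Modulo the two coordinates every polynomial is a constant, and a nonzero constant in `q` would
be a unit. -/
lemma eq_span_of_X_mem {q : Ideal (MvPolynomial (Fin 2) k)} [hq : q.IsPrime]
    (hX0 : X 0 ∈ q) (hX1 : X 1 ∈ q) : q = Ideal.span {X 0, X 1} := by
  have hmem : Ideal.span {X 0, X 1} ≤ q := by
    rw [Ideal.span_le]; rintro _ (rfl | rfl); exacts [hX0, hX1]
  refine le_antisymm (fun f hf ↦ ?_) hmem
  obtain ⟨b, hb⟩ := Ideal.mem_span_singleton.1 (sub_restrictAxis_mem (zero_ne_one) f)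
  set g := restrictAxis k 0 f
  obtain ⟨c, hc⟩ : Polynomial.X ∣ g - Polynomial.C (g.coeff 0) := by
    rw [Polynomial.X_dvd_iff]; simp
  have h0 : g.coeff 0 = 0 := by
    by_contra h0
    apply hq.ne_top
    have h2 : C (g.coeff 0) ∈ q := by
      have h3 := congrArg (Polynomial.aeval (X 1 : MvPolynomial (Fin 2) k)) hc
      simp only [map_sub, map_mul, Polynomial.aeval_C, Polynomial.aeval_X, algebraMap_eq] at h3
      have h4 : C (g.coeff 0) = f - X 0 * b - X 1 * Polynomial.aeval (X 1) c := by
        linear_combination -hb - h3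
      rw [h4]
      exact q.sub_mem (q.sub_mem hf (q.mul_mem_right _ hX0)) (q.mul_mem_right _ hX1)
    exact q.eq_top_of_isUnit_mem h2 ((isUnit_iff_ne_zero.2 h0).map C)
  rw [h0, map_zero, sub_zero] at hc
  rw [hc, map_mul, Polynomial.aeval_X] at hb
  rw [Ideal.mem_span_pair]
  exact ⟨b, Polynomial.aeval (X 1) c, by linear_combination -hb⟩

/-- Coordinate divisors of the affine plane have strict normal crossings. -/
lemma exists_parameters_of_mem {q : Ideal (MvPolynomial (Fin 2) k)} [hq : q.IsPrime]
    {ε : Fin 2 → ℕ} (hε : ∀ l, ε l ≤ 1) {w : MvPolynomial (Fin 2) k} (hw : w ∉ q)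
    (hf : X 0 ^ ε 0 * X 1 ^ ε 1 ∈ q) :
    ∃ (d : ℕ) (t : Fin d → MvPolynomial (Fin 2) k) (s : Finset (Fin d)) (w' : _),
      q.height = d ∧ Ideal.span (Set.range t) = q ∧ w' ∉ q ∧
      w * (X 0 ^ ε 0 * X 1 ^ ε 1) = w' * ∏ i ∈ s, t i := by
  by_cases h : X 0 ∈ q ∧ X 1 ∈ q
  · have hq' := eq_span_of_X_mem h.1 h.2
    refine ⟨2, ![X 0, X 1], Finset.univ.filter fun l ↦ ε l = 1, w, height_eq_two hq' ?_, ?_, hw, ?_⟩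
    · rw [Ideal.mem_span_singleton]; exact not_X_dvd_X zero_ne_one
    · rw [hq']; simp [Set.pair_comm]
    · rw [Finset.prod_filter, Fin.prod_univ_two]
      have h0 := hε 0
      have h1 := hε 1
      congr 2
      · interval_cases ε 0 <;> simp
      · interval_cases ε 1 <;> simp
  · have hone : ∃ l m, l ≠ m ∧ X l ∈ q ∧ X m ∉ q ∧ ε l = 1 := by
      rcases hq.mem_or_mem hf with h' | h'
      · refine ⟨0, 1, zero_ne_one, hq.mem_of_pow_mem _ h', fun h1 ↦ h ⟨hq.mem_of_pow_mem _ h', h1⟩,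
          le_antisymm (hε 0) (Nat.one_le_iff_ne_zero.2 fun h0 ↦ ?_)⟩
        rw [h0, pow_zero] at h'
        exact hq.ne_top ((Ideal.eq_top_iff_one q).2 h')
      · refine ⟨1, 0, one_ne_zero, hq.mem_of_pow_mem _ h', fun h1 ↦ h ⟨h1, hq.mem_of_pow_mem _ h'⟩,
          le_antisymm (hε 1) (Nat.one_le_iff_ne_zero.2 fun h0 ↦ ?_)⟩
        rw [h0, pow_zero] at h'
        exact hq.ne_top ((Ideal.eq_top_iff_one q).2 h')
    obtain ⟨l, m, hlm, hl, hm, hεl⟩ := hone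
    obtain ⟨d, t, i, hd, ht, hi⟩ := exists_parameters_of_X_mem hl
    -- Only the axis `X l = 0` passes through `q`; the other coordinate does not vanish there and is
    -- absorbed into the factor outside `q`.
    refine ⟨d, t, {i}, w * X m ^ ε m, hd, ht,
      fun h' ↦ (hq.mem_or_mem h').elim hw fun h' ↦ hm (hq.mem_of_pow_mem _ h'), ?_⟩
    have : (X 0 : MvPolynomial (Fin 2) k) ^ ε 0 * X 1 ^ ε 1 = X l ^ ε l * X m ^ ε m := by
      rcases fin_two_ne_cases hlm with
        ⟨rfl, rfl⟩ | ⟨rfl, rfl⟩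
      · rfl
      · rw [mul_comm]
    rw [this, hεl, Finset.prod_singleton, hi]
    ring

/-- The reduced equation of a monomial divisor. -/
lemma radical_span_monomial (d b : ℕ) :
    (Ideal.span {(X 0 ^ d * X 1 ^ b : MvPolynomial (Fin 2) k)}).radical =
      Ideal.span {X 0 ^ min d 1 * X 1 ^ min b 1} := by
  apply le_antisymm
  · intro f hf
    obtain ⟨n, hn⟩ := hf
    rw [Ideal.mem_span_singleton] at hn ⊢
    have key (l : Fin 2) (e : ℕ) (h : (X l : MvPolynomial (Fin 2) k) ^ e ∣ f ^ n) :
        (X l : MvPolynomial (Fin 2) k) ^ min e 1 ∣ f := by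
      rcases Nat.eq_zero_or_pos e with rfl | he
      · simp
      · rw [min_eq_right he, pow_one]
        exact X_prime.dvd_of_dvd_pow ((dvd_pow_self _ he.ne').trans h)
    have h0 := key 0 d ((dvd_mul_right _ _).trans hn)
    have h1 := key 1 b ((dvd_mul_left _ _).trans hn)
    rcases Nat.eq_zero_or_pos b with rfl | hb
    · simpa using h0
    rcases Nat.eq_zero_or_pos d with rfl | hd
    · simpa using h1
    rw [min_eq_right hd, pow_one] at h0 ⊢
    rw [min_eq_right hb, pow_one] at h1 ⊢
    obtain ⟨g, rfl⟩ := h0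
    refine mul_dvd_mul_left _ ((X_prime.dvd_or_dvd h1).resolve_left ?_)
    exact not_X_dvd_X one_ne_zero
  · rw [Ideal.span_singleton_le_iff_mem]
    -- The exponent `d + b` is at least `d` and `b`, so this power of the reduced monomial is
    -- divisible by the given one.
    refine ⟨d + b, Ideal.mem_span_singleton.2 ?_⟩
    rw [mul_pow, ← pow_mul, ← pow_mul]
    refine mul_dvd_mul (pow_dvd_pow _ ?_) (pow_dvd_pow _ ?_)
    · rcases Nat.eq_zero_or_pos d with rfl | hd
      · simp
      · rw [min_eq_right hd]; omega
    · rcases Nat.eq_zero_or_pos b with rfl | hd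
      · simp
      · rw [min_eq_right hd]; omega

lemma isRadical_span_monomial {d b : ℕ} (hd : d ≤ 1) (hb : b ≤ 1) :
    (Ideal.span {(X 0 ^ d * X 1 ^ b : MvPolynomial (Fin 2) k)}).radical =
      Ideal.span {X 0 ^ d * X 1 ^ b} := by
  rw [radical_span_monomial, min_eq_left hd, min_eq_left hb]

instance isPrime_ker_constantCoeff :
    (RingHom.ker (constantCoeff : MvPolynomial (Fin 2) k →+* k)).IsPrime :=
  RingHom.ker_isPrime _

variable (k) in
/-- The origin of the affine plane. -/
def origin : Spec (AffinePlaneRing k) :=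
  ⟨RingHom.ker (constantCoeff : MvPolynomial (Fin 2) k →+* k), inferInstance⟩

lemma X_mem_origin (l : Fin 2) : (X l : MvPolynomial (Fin 2) k) ∈ (origin k).asIdeal := by
  change constantCoeff (X l) = 0
  simp

lemma origin_asIdeal : (origin k).asIdeal = Ideal.span {X 0, X 1} :=
  eq_span_of_X_mem (hq := (origin k).isPrime) (X_mem_origin 0) (X_mem_origin 1)

lemma eq_origin {q : Spec (AffinePlaneRing k)} (h0 : X 0 ∈ q.asIdeal) (h1 : X 1 ∈ q.asIdeal) :
    q = origin k := by
  apply PrimeSpectrum.ext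
  rw [origin_asIdeal]
  exact eq_span_of_X_mem (hq := PrimeSpectrum.isPrime q) h0 h1

lemma eq_origin_of_ne {q : Spec (AffinePlaneRing k)} {l m : Fin 2} (h : l ≠ m)
    (h0 : X l ∈ q.asIdeal) (h1 : X m ∈ q.asIdeal) : q = origin k := by
  rcases fin_two_ne_cases h with
    ⟨rfl, rfl⟩ | ⟨rfl, rfl⟩
  exacts [eq_origin h0 h1, eq_origin h1 h0]

variable (k) in
/-- The coordinate axis on which `X l` vanishes. -/
def coordAxis (l : Fin 2) : Set (Spec (AffinePlaneRing k)) := {q | X l ∈ q.asIdeal}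

lemma isClosed_coordAxis (l : Fin 2) : IsClosed (coordAxis k l) := by
  have : coordAxis k l = PrimeSpectrum.zeroLocus {(X l : MvPolynomial (Fin 2) k)} := by
    ext q
    exact (Set.singleton_subset_iff (s := (SetLike.coe (PrimeSpectrum.asIdeal q)))).symm
  rw [this]
  exact PrimeSpectrum.isClosed_zeroLocus _

/-- The generic point `(X m)` of one axis is not on the other, and its closure is the whole axis.
This computes strict transforms in charts. -/
lemma closure_coordAxis_diff {l m : Fin 2} (h : l ≠ m) :
    closure (coordAxis k m \ coordAxis k l) = coordAxis k m := by
  refine ((isClosed_coordAxis m).closure_subset_iff.2 Set.sdiff_subset).antisymm fun q hq ↦ ?_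
  have hp : (Ideal.span {(X m : MvPolynomial (Fin 2) k)}).IsPrime :=
    (Ideal.span_singleton_prime (X_ne_zero m)).2 X_prime
  let g : PrimeSpectrum (AffinePlaneRing k) := ⟨_, hp⟩
  have hg : g ∈ coordAxis k m \ coordAxis k l :=
    ⟨Ideal.mem_span_singleton_self _, fun h' ↦ not_X_dvd_X h.symm (Ideal.mem_span_singleton.1 h')⟩
  have hs : g ⤳ (show PrimeSpectrum (AffinePlaneRing k) from q) := by
    rw [← PrimeSpectrum.le_iff_specializes]
    exact (Ideal.span_singleton_le_iff_mem _).2 hq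
  exact closure_mono (Set.singleton_subset_iff.2 hg) (specializes_iff_mem_closure.1 hs)

lemma coordAxis_injective {l m : Fin 2} (h : coordAxis k l = coordAxis k m) : l = m := by
  by_contra hlm
  have := closure_coordAxis_diff (k := k) hlm
  rw [h, Set.sdiff_self, closure_empty] at this
  exact Set.notMem_empty _ (this.ge (show origin k ∈ coordAxis k m from X_mem_origin m))

end Ring

end

/-! ### Standard charts of the projective plane and the chart centred at `[1 : 0 : 1]`. -/

section

open MvPolynomial HomogeneousLocalization

section PlaneCharts

variable (k : Type u) [Field k]

/-- The homogeneous coordinate ring of the projective plane with its grading. -/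
abbrev planeGrading : ℕ → Submodule k (MvPolynomial (Fin 3) k) := homogeneousSubmodule (Fin 3) k

variable {k} in
lemma X_mem_planeGrading (i : Fin 3) : X i ∈ planeGrading k 1 :=
  (mem_homogeneousSubmodule _ _).2 (isHomogeneous_X k i)

/-- Dehomogenization with respect to the `j`-th homogeneous coordinate. -/
def dehomogenize (j : Fin 3) : MvPolynomial (Fin 3) k →+* MvPolynomial (Fin 2) k :=
  eval₂Hom C (j.insertNth 1 fun l ↦ X l)

lemma dehomogenize_X_self (j : Fin 3) : dehomogenize k j (X j) = 1 := by simp [dehomogenize]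

lemma isUnit_dehomogenize_X (j : Fin 3) : IsUnit (dehomogenize k j (X j)) := by
  rw [dehomogenize_X_self]; exact isUnit_one

lemma dehomogenize_X_succAbove (j : Fin 3) (l : Fin 2) :
    dehomogenize k j (X (j.succAbove l)) = X l := by simp [dehomogenize]

/-- The quotient `X i / X j`. -/
def coordQuotient (j i : Fin 3) : Away (planeGrading k) (X j) :=
  Away.mk _ (X_mem_planeGrading j) 1 (X i) (by simpa using X_mem_planeGrading i)

/-- The ring of regular functions on a standard chart is a polynomial ring. -/
def awayToAffine (j : Fin 3) : Away (planeGrading k) (X j) →+* MvPolynomial (Fin 2) k :=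
  (IsLocalization.Away.lift (S := Localization.Away (X j : MvPolynomial (Fin 3) k))
    (X j) (g := dehomogenize k j) (isUnit_dehomogenize_X k j)).comp
    (algebraMap (Away (planeGrading k) (X j)) (Localization.Away (X j : MvPolynomial (Fin 3) k)))

lemma awayToAffine_mk (j : Fin 3) (n : ℕ) (f : MvPolynomial (Fin 3) k)
    (hf : f ∈ planeGrading k (n • 1)) :
    awayToAffine k j (Away.mk _ (X_mem_planeGrading j) n f hf) = dehomogenize k j f := by
  have h1 : algebraMap _ (Localization.Away (X j : MvPolynomial (Fin 3) k)) f =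
      algebraMap (MvPolynomial (Fin 3) k) _ (X j ^ n) *
        (Away.mk _ (X_mem_planeGrading j) n f hf).val := by
    rw [Away.val_mk, Localization.mk_eq_mk']
    exact (IsLocalization.mk'_spec' _ _ _).symm
  have h2 := congrArg (IsLocalization.Away.lift
    (S := Localization.Away (X j : MvPolynomial (Fin 3) k)) (X j) (g := dehomogenize k j)
    (isUnit_dehomogenize_X k j)) h1
  rw [IsLocalization.Away.lift_eq, map_mul, IsLocalization.Away.lift_eq, map_pow] at h2
  rw [h2, dehomogenize_X_self k j, one_pow, one_mul]
  rfl

lemma awayToAffine_coordQuotient (j i : Fin 3) :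
    awayToAffine k j (coordQuotient k j i) = dehomogenize k j (X i) :=
  awayToAffine_mk ..

/-- The constants as regular functions on a standard chart. -/
def awayC (j : Fin 3) : k →+* Away (planeGrading k) (X j) :=
  (fromZeroRingHom (planeGrading k) _).comp (algebraMap k (planeGrading k 0))

lemma val_awayC (j : Fin 3) (c : k) : (awayC k j c).val =
    algebraMap (MvPolynomial (Fin 3) k)
      (Localization.Away (X j : MvPolynomial (Fin 3) k)) (C c) := by
  rw [← Localization.mk_one_eq_algebraMap]
  rfl

/-- Homogeneity lets `X j ^ n` clear the denominators of `f(X i / X j)` monomial by monomial. The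
injectivity of dehomogenization on the chart rests on this identity. -/
lemma val_eval₂_coordQuotient (j : Fin 3) (n : ℕ) (f : MvPolynomial (Fin 3) k)
    (hf : f ∈ planeGrading k n) :
    algebraMap (MvPolynomial (Fin 3) k) (Localization.Away (X j : MvPolynomial (Fin 3) k))
      (X j ^ n) *
      (eval₂Hom (awayC k j) (coordQuotient k j) f).val =
    algebraMap _ (Localization.Away (X j : MvPolynomial (Fin 3) k)) f := by
  set L := Localization.Away (X j : MvPolynomial (Fin 3) k)
  have hq (i : Fin 3) : algebraMap (MvPolynomial (Fin 3) k) L (X j) * (coordQuotient k j i).val =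
      algebraMap (MvPolynomial (Fin 3) k) L (X i) := by
    have := IsLocalization.mk'_spec' L (X i : MvPolynomial (Fin 3) k)
      (⟨X j ^ 1, 1, rfl⟩ : Submonoid.powers (X j : MvPolynomial (Fin 3) k))
    rw [coordQuotient, Away.val_mk, Localization.mk_eq_mk']
    simpa only [pow_one] using this
  have hval : (eval₂Hom (awayC k j) (coordQuotient k j) f).val =
      eval₂ ((algebraMap (MvPolynomial (Fin 3) k) L).comp (C : k →+* MvPolynomial (Fin 3) k))
        (fun i ↦ ((coordQuotient k j i).val : L)) f := by
    change algebraMap (Away (planeGrading k) (X j)) L _ = _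
    rw [coe_eval₂Hom, hom_eval₂]
    congr 1
  rw [hval, eval₂_eq, Finset.mul_sum]
  conv_rhs => rw [f.as_sum, map_sum]
  refine Finset.sum_congr rfl fun d hd ↦ ?_
  have hdeg : ∑ i, d i = n := by
    have := ((mem_homogeneousSubmodule _ _).1 hf) (mem_support_iff.1 hd)
    rw [← this, Finsupp.weight_apply, Finsupp.sum_fintype _ _ (by simp)]
    simp
  rw [monomial_eq, map_mul, Finsupp.prod_fintype _ _ (by simp), map_prod, ← hdeg,
    ← Finset.prod_pow_eq_pow_sum, map_prod]
  rw [Finset.prod_subset (Finset.subset_univ d.support) (by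
    intro i _ hi
    rw [Finsupp.notMem_support_iff.1 hi, pow_zero])]
  rw [mul_left_comm, ← Finset.prod_mul_distrib]
  congr 1
  refine Finset.prod_congr rfl fun i _ ↦ ?_
  rw [map_pow, map_pow, ← mul_pow, hq]

/-- Substituting the quotients `X i / X j` gives a right inverse. Conversely, a homogeneous `f` is
recovered in the localization from its dehomogenization, so a fraction whose dehomogenization is
zero vanishes. -/
lemma awayToAffine_bijective (j : Fin 3) : Function.Bijective (awayToAffine k j) := by
  have hC (c : k) : awayToAffine k j (awayC k j c) = C c := by
    change IsLocalization.Away.lift (S := Localization.Away (X j : MvPolynomial (Fin 3) k)) (X j)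
      (isUnit_dehomogenize_X k j) (awayC k j c).val = _
    rw [val_awayC, IsLocalization.Away.lift_eq]
    simp [dehomogenize]
  have hinv (g) : awayToAffine k j
      (eval₂Hom (awayC k j) (fun l ↦ coordQuotient k j (j.succAbove l)) g) = g := by
    have : (awayToAffine k j).comp (eval₂Hom (awayC k j)
        (fun l ↦ coordQuotient k j (j.succAbove l))) = RingHom.id _ := by
      refine MvPolynomial.ringHom_ext (fun r ↦ ?_) fun l ↦ ?_
      · simp [hC]
      · simp [awayToAffine_coordQuotient, dehomogenize_X_succAbove]
    exact DFunLike.congr_fun this g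
  have hone : coordQuotient k j j = 1 := by
    apply val_injective
    rw [coordQuotient, Away.val_mk, val_one, Localization.mk_eq_mk']
    simp
  have hcomp : (eval₂Hom (awayC k j) (fun l ↦ coordQuotient k j (j.succAbove l))).comp
      (dehomogenize k j) = eval₂Hom (awayC k j) (coordQuotient k j) := by
    refine MvPolynomial.ringHom_ext (fun r ↦ ?_) fun i ↦ ?_
    · simp [dehomogenize]
    · rcases j.eq_self_or_eq_succAbove i with rfl | ⟨l, rfl⟩
      · simp [dehomogenize_X_self, hone]
      · simp [dehomogenize_X_succAbove]
  constructor
  · rw [injective_iff_map_eq_zero]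
    intro a ha
    obtain ⟨n, f, hf, rfl⟩ := Away.mk_surjective (planeGrading k) (X_mem_planeGrading j) a
    rw [awayToAffine_mk] at ha
    have h1 := val_eval₂_coordQuotient k j n f (by simpa using hf)
    rw [← hcomp, RingHom.comp_apply, ha, map_zero, val_zero, mul_zero] at h1
    apply val_injective
    rw [Away.val_mk, val_zero, Localization.mk_eq_mk', IsLocalization.mk'_eq_zero_iff]
    obtain ⟨c, hc⟩ := (IsLocalization.map_eq_zero_iff (Submonoid.powers
      (X j : MvPolynomial (Fin 3) k)) _ _).1 h1.symm
    exact ⟨c, hc⟩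
  · exact fun g ↦ ⟨_, hinv g⟩

/-- The standard chart of the projective plane on which the `j`-th coordinate does not vanish. -/
def planeChart (j : Fin 3) : Spec (AffinePlaneRing k) ⟶ Plane k :=
  Spec.map (CommRingCat.ofHom (awayToAffine k j)) ≫
    Proj.awayι (planeGrading k) (X j) (X_mem_planeGrading j) one_pos

instance (j : Fin 3) : IsOpenImmersion (planeChart k j) := by
  have : IsIso (CommRingCat.ofHom (awayToAffine k j)) :=
    (RingEquiv.ofBijective _ (awayToAffine_bijective k j)).toCommRingCatIso.isIso_hom
  delta planeChart; infer_instance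

variable {k}

lemma planeChart_mem_basicOpen_iff (j : Fin 3) (q : Spec (AffinePlaneRing k))
    {g : MvPolynomial (Fin 3) k} (hg : g ∈ planeGrading k 1) :
    planeChart k j q ∈ Proj.basicOpen (planeGrading k) g ↔ dehomogenize k j g ∉ q.asIdeal := by
  have h : planeChart k j q ∈ Proj.basicOpen (planeGrading k) g ↔
      Spec.map (CommRingCat.ofHom (awayToAffine k j)) q ∈
        Proj.awayι (planeGrading k) (X j) (X_mem_planeGrading j) one_pos ⁻¹ᵁ
          Proj.basicOpen (planeGrading k) g := by
    rw [planeChart, Scheme.Hom.comp_apply]; rfl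
  rw [h, Proj.awayι_preimage_basicOpen _ _ _ hg one_pos]
  change awayToAffine k j (Away.isLocalizationElem (X_mem_planeGrading j) hg) ∉ q.asIdeal ↔ _
  rw [Away.isLocalizationElem, awayToAffine_mk, pow_one]

lemma planeChart_mem_coordLine_iff (j i : Fin 3) (q : Spec (AffinePlaneRing k)) :
    planeChart k j q ∈ coordLine k i ↔ dehomogenize k j (X i) ∈ q.asIdeal := by
  have h := planeChart_mem_basicOpen_iff j q (X_mem_planeGrading (k := k) i)
  rw [← not_iff_not, ← h]
  rfl

lemma opensRange_planeChart (j : Fin 3) :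
    (planeChart k j).opensRange = Proj.basicOpen (planeGrading k) (X j) := by
  have : IsIso (CommRingCat.ofHom (awayToAffine k j)) :=
    (RingEquiv.ofBijective _ (awayToAffine_bijective k j)).toCommRingCatIso.isIso_hom
  exact (Scheme.Hom.opensRange_comp_of_isIso _ _).trans (Proj.opensRange_awayι ..)

lemma exists_planeChart_eq (x : Plane k) : ∃ j q, planeChart k j q = x := by
  have h : ⨆ i : Fin 3, Proj.basicOpen (planeGrading k) (X i) = ⊤ := by
    refine Proj.iSup_basicOpen_eq_top' _ _ (fun i ↦ ⟨1, X_mem_planeGrading i⟩) ?_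
    rw [eq_top_iff]
    intro f _
    induction f using MvPolynomial.induction_on with
    | C c => exact Subalgebra.algebraMap_mem _ (⟨C c, isHomogeneous_C _ c⟩ : planeGrading k 0)
    | add p q hp hq => exact add_mem (hp trivial) (hq trivial)
    | mul_X p i hp => exact mul_mem (hp trivial) (Algebra.subset_adjoin ⟨i, rfl⟩)
  have hx : x ∈ ⨆ i : Fin 3, Proj.basicOpen (planeGrading k) (X i) := by rw [h]; trivial
  obtain ⟨j, hj⟩ := Opens.mem_iSup.1 hx
  rw [← opensRange_planeChart] at hj
  obtain ⟨q, hq⟩ := hj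
  exact ⟨j, q, hq⟩

lemma isPrime_span_X (l : Fin 2) : (Ideal.span {(X l : MvPolynomial (Fin 2) k)}).IsPrime :=
  (Ideal.span_singleton_prime (X_ne_zero l)).2 X_prime

open Scheme.IdealSheafData in
/-- A radical ideal is determined by the primes containing it. -/
lemma pull_vanishingIdeal_eq_of_iff {X : Scheme.{u}} {R : CommRingCat.{u}} (Z : Closeds X)
    (χ : Spec R ⟶ X) [IsOpenImmersion χ] {a : Ideal R} (ha : a.IsRadical)
    (h : ∀ q, χ q ∈ Z ↔ a ≤ q.asIdeal) : (vanishingIdeal Z).pull χ = a := by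
  ext r
  rw [mem_pull_vanishingIdeal_iff]
  refine ⟨fun hr ↦ ?_, fun hr q hq ↦ (h q).1 hq hr⟩
  rw [← ha.radical, Ideal.radical_eq_sInf]
  simp only [Ideal.mem_sInf, Set.mem_ofPred_eq]
  intro J hJ
  exact hr ⟨J, hJ.2⟩ ((h ⟨J, hJ.2⟩).2 hJ.1)

open Scheme.IdealSheafData

/-- The ideal sheaf of a coordinate line in a standard chart. -/
lemma pull_coordLine (j i : Fin 3) :
    pull (vanishingIdeal (coordLine k i)) (planeChart k j) =
      (Ideal.span {dehomogenize k j (X i)} : Ideal (MvPolynomial (Fin 2) k)) := by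
  refine pull_vanishingIdeal_eq_of_iff _ _ ?_ fun q ↦ ?_
  · rcases j.eq_self_or_eq_succAbove i with rfl | ⟨l, rfl⟩
    · rw [dehomogenize_X_self, Ideal.span_singleton_one]
      exact (Ideal.radical_top (MvPolynomial (Fin 2) k)).le
    · rw [dehomogenize_X_succAbove]
      exact (isPrime_span_X l).isRadical
  · rw [planeChart_mem_coordLine_iff, Ideal.span_singleton_le_iff_mem]

/-! The chart `Z ≠ 0`, centred at the point `[1 : 0 : 1]`. -/

/-- The translation of the affine plane that moves the origin to `(1, 0)`. -/
def translation (k : Type u) [Field k] : MvPolynomial (Fin 2) k ≃ₐ[k] MvPolynomial (Fin 2) k :=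
  AlgEquiv.ofAlgHom (aeval ![1 + X 0, X 1]) (aeval ![X 0 - 1, X 1])
    (by ext l; fin_cases l <;> simp) (by ext l; fin_cases l <;> simp)

lemma translation_X_zero : translation k (X 0) = 1 + X 0 := by simp [translation]

lemma translation_X_one : translation k (X 1) = X 1 := by simp [translation]

variable (k) in
/-- The chart of the plane with coordinates `x - 1` and `y`. -/
def centredChart : Spec (AffinePlaneRing k) ⟶ Plane k :=
  Spec.map (CommRingCat.ofHom (translation k).toRingEquiv.toRingHom) ≫ planeChart k 2

lemma isIso_translation : IsIso (CommRingCat.ofHom (translation k).toRingEquiv.toRingHom) :=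
  (translation k).toRingEquiv.toCommRingCatIso.isIso_hom

instance : IsOpenImmersion (centredChart k) := by
  have := isIso_translation (k := k)
  delta centredChart; infer_instance

lemma opensRange_centredChart : (centredChart k).opensRange = chartZ k := by
  have := isIso_translation (k := k)
  exact (Scheme.Hom.opensRange_comp_of_isIso _ _).trans (opensRange_planeChart 2)

lemma pull_centredChart (i : Fin 3) : (vanishingIdeal (coordLine k i)).pull (centredChart k) =
    Ideal.span {translation k (dehomogenize k 2 (X i))} := by
  rw [centredChart, pull_specMap, pull_coordLine, Ideal.map_span, Set.image_singleton]
  rfl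

lemma dehomogenize_two_X_zero : dehomogenize k 2 (X 0) = X 0 := by
  exact dehomogenize_X_succAbove k 2 0

lemma dehomogenize_two_X_one : dehomogenize k 2 (X 1) = X 1 := by
  exact dehomogenize_X_succAbove k 2 1

lemma centredChart_mem_basicOpen_iff (q : Spec (AffinePlaneRing k))
    {g : MvPolynomial (Fin 3) k} (hg : g ∈ planeGrading k 1) :
    centredChart k q ∈ Proj.basicOpen (planeGrading k) g ↔
      translation k (dehomogenize k 2 g) ∉ q.asIdeal := by
  rw [centredChart, Scheme.Hom.comp_apply, planeChart_mem_basicOpen_iff _ _ hg]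
  rfl

lemma centredChart_mem_coordLine_iff (q : Spec (AffinePlaneRing k)) :
    centredChart k q ∈ coordLine k 1 ↔ (X 1 : MvPolynomial (Fin 2) k) ∈ q.asIdeal := by
  rw [centredChart, Scheme.Hom.comp_apply, planeChart_mem_coordLine_iff, dehomogenize_two_X_one]
  change translation k (X 1) ∈ q.asIdeal ↔ _
  rw [translation_X_one]

/-- The point `[1 : 0 : 1]` is the origin of the chart. -/
lemma eq_centredChart_origin (x : Plane k) (hx : x.asHomogeneousIdeal.toIdeal =
    Ideal.span {(X 1 : MvPolynomial (Fin 3) k), X 0 - X 2}) :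
    x = centredChart k (origin k) := by
  have h2 : x ∈ (centredChart k).opensRange := by
    rw [opensRange_centredChart]
    change (X 2 : MvPolynomial (Fin 3) k) ∉ x.asHomogeneousIdeal.toIdeal
    rw [hx]
    intro h
    -- Evaluation at `(1, 0, 1)` kills both generators but not `X 2`, so the point lies in the chart
    -- `Z ≠ 0`.
    have : Ideal.span {(X 1 : MvPolynomial (Fin 3) k), X 0 - X 2} ≤
        RingHom.ker (eval ![1, 0, 1] : MvPolynomial (Fin 3) k →+* k) := by
      rw [Ideal.span_le]
      rintro _ (rfl | rfl) <;> simp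
    simpa using this h
  obtain ⟨q, rfl⟩ := h2
  rw [eq_origin (q := q)]
  · by_contra h
    have hg : (X 0 - X 2 : MvPolynomial (Fin 3) k) ∈ planeGrading k 1 :=
      sub_mem (X_mem_planeGrading 0) (X_mem_planeGrading 2)
    refine (centredChart_mem_basicOpen_iff q hg).2 ?_ ?_
    · rw [map_sub, dehomogenize_X_self, dehomogenize_two_X_zero, map_sub, map_one,
        translation_X_zero, add_sub_cancel_left]
      exact h
    · change _ ∈ (HomogeneousIdeal.toIdeal _)
      rw [hx]
      exact Ideal.subset_span (by simp)
  · rw [← centredChart_mem_coordLine_iff]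
    change _ ∈ (HomogeneousIdeal.toIdeal _)
    rw [hx]
    exact Ideal.subset_span (by simp)

/-- The two identifications of the homogeneous localization with sections on a basic open set are
compatible; this is what makes `affineCoord` computable in the chart. -/
lemma awayToSection_appLE_awayι {m : ℕ} {f : MvPolynomial (Fin 3) k} (hf : f ∈ planeGrading k m)
    (hm : 0 < m) (e) :
    Proj.awayToSection (planeGrading k) f ≫
      (Proj.awayι (planeGrading k) f hf hm).appLE (Proj.basicOpen (planeGrading k) f) ⊤ e =
    (Scheme.ΓSpecIso _).inv := by
  have h := Proj.basicOpenToSpec_app_top (planeGrading k) f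
  have h1 : (Proj.basicOpen (planeGrading k) f).ι.appLE (Proj.basicOpen (planeGrading k) f) ⊤
      (by simp) = (Proj.basicOpen (planeGrading k) f).topIso.inv := by
    simp only [Scheme.Hom.appLE, Scheme.Opens.ι_app, Scheme.Opens.topIso_inv]
    erw [← Functor.map_comp]
    rfl
  have h2 : (Proj.awayι (planeGrading k) f hf hm).appLE (Proj.basicOpen (planeGrading k) f) ⊤ e =
      (Proj.basicOpen (planeGrading k) f).topIso.inv ≫
        (Proj.basicOpenIsoSpec (planeGrading k) f hf hm).inv.appTop := by
    rw [← h1, Scheme.Hom.appTop, ← Scheme.Hom.appLE_eq_app]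
    exact (Scheme.Hom.appLE_comp_appLE _ _ _ _ _ _ _).symm
  have h3 : (Proj.basicOpenToSpec (planeGrading k) f).app ⊤ ≫
      (Proj.basicOpenIsoSpec (planeGrading k) f hf hm).inv.appTop = 𝟙 _ := by
    have := Scheme.Hom.comp_appTop (Proj.basicOpenIsoSpec (planeGrading k) f hf hm).inv
      (Proj.basicOpenIsoSpec (planeGrading k) f hf hm).hom
    rw [Iso.inv_hom_id, Scheme.Hom.id_appTop] at this
    exact this.symm
  rw [h2, ← Category.assoc, ← Iso.hom_comp_eq_id, ← Category.assoc, ← h]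
  exact h3

/-- The affine coordinates on the chart. -/
lemma appLE_affineCoord (i : Fin 3) (e) :
    ((centredChart k).appLE (chartZ k) ⊤ e).hom (affineCoord k i) =
      (Scheme.ΓSpecIso (AffinePlaneRing k)).inv.hom (translation k (dehomogenize k 2 (X i))) := by
  let φ := CommRingCat.ofHom (awayToAffine k 2) ≫
    CommRingCat.ofHom (translation k).toRingEquiv.toRingHom
  have e1 : centredChart k = Spec.map φ ≫
      Proj.awayι (planeGrading k) (X 2) (X_mem_planeGrading 2) one_pos := by
    rw [Spec.map_comp, Category.assoc]; rfl
  have e2 : ⊤ ≤ Proj.awayι (planeGrading k) (X 2) (X_mem_planeGrading 2) one_pos ⁻¹ᵁ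
      Proj.basicOpen (planeGrading k) (X 2) := by
    rw [← Proj.opensRange_awayι _ _ (X_mem_planeGrading 2) one_pos]
    exact fun x _ ↦ ⟨x, rfl⟩
  have h1 : (centredChart k).appLE (chartZ k) ⊤ e =
      (Proj.awayι (planeGrading k) (X 2) (X_mem_planeGrading 2) one_pos).appLE (chartZ k) ⊤ e2 ≫
        (Spec.map φ).appTop := by
    rw [Scheme.Hom.appTop, ← Scheme.Hom.appLE_eq_app]
    refine Eq.trans ?_ (Scheme.Hom.appLE_comp_appLE _ _ _ _ _ _ _).symm
    congr 1
  have h2 := awayToSection_appLE_awayι (X_mem_planeGrading (k := k) 2) one_pos e2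
  have h3 : Proj.awayToSection (planeGrading k) (X 2) ≫ (centredChart k).appLE (chartZ k) ⊤ e =
      φ ≫ (Scheme.ΓSpecIso (AffinePlaneRing k)).inv := by
    rw [h1, Scheme.ΓSpecIso_inv_naturality, ← h2, Category.assoc]
    rfl
  have h4 := congrArg (fun f ↦ f.hom (coordQuotient k 2 i)) h3
  refine h4.trans ?_
  change (Scheme.ΓSpecIso (AffinePlaneRing k)).inv.hom
    (translation k (awayToAffine k 2 (coordQuotient k 2 i))) = _
  rw [awayToAffine_coordQuotient]

end PlaneCharts

end

/-! ### Mediants, and towers of blowups in monomial coordinates. -/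

section

open MvPolynomial Scheme.IdealSheafData

/-! ### Mediants -/

/-- Insertion is local: removing the head of a longer list only removes the first two entries of its
image, so induction on the part before the pair reduces to the pair standing first. -/
lemma infix_insertMediants {p q : ℕ × ℕ} {L : List (ℕ × ℕ)} (h : [p, q] <:+: L) :
    [p, (p.1 + q.1, p.2 + q.2)] <:+: insertMediants L ∧
      [(p.1 + q.1, p.2 + q.2), q] <:+: insertMediants L := by
  obtain ⟨s, t, rfl⟩ := h
  induction s with
  | nil =>
    cases t with
    | nil => exact ⟨⟨[], [q], rfl⟩, ⟨[p], [], rfl⟩⟩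
    | cons r t => exact ⟨⟨[], q :: _, rfl⟩, ⟨[p], (q.1 + r.1, q.2 + r.2) :: _, rfl⟩⟩
  | cons r s ih =>
    obtain ⟨r', l, hl⟩ : ∃ r' l, s ++ [p, q] ++ t = r' :: l := by
      cases s <;> exact ⟨_, _, rfl⟩
    have : insertMediants (r :: s ++ [p, q] ++ t) =
        [r, (r.1 + r'.1, r.2 + r'.2)] ++ insertMediants (s ++ [p, q] ++ t) := by
      rw [List.cons_append, List.cons_append, hl]; rfl
    rw [this]
    exact ⟨ih.1.trans (List.suffix_append _ _).isInfix, ih.2.trans (List.suffix_append _ _).isInfix⟩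

namespace FareyNeighbors

variable {n a b c d : ℕ}

lemma mediant_right (hn : 1 ≤ n) (h : FareyNeighbors n a b c d) :
    FareyNeighbors (n + 1) a b (a + c) (b + d) := by
  obtain ⟨n, rfl⟩ := Nat.exists_eq_succ_of_ne_zero (Nat.one_le_iff_ne_zero.1 hn)
  exact (infix_insertMediants h).1

lemma mediant_left (hn : 1 ≤ n) (h : FareyNeighbors n a b c d) :
    FareyNeighbors (n + 1) (a + c) (b + d) c d := by
  obtain ⟨n, rfl⟩ := Nat.exists_eq_succ_of_ne_zero (Nat.one_le_iff_ne_zero.1 hn)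
  exact (infix_insertMediants h).2

lemma one : FareyNeighbors 1 0 1 1 1 := List.infix_rfl

end FareyNeighbors

/-! ### Monomial charts -/

section Monomial

variable {k : Type u} [Field k]

variable (k) in
/-- The homomorphism that sends the coordinates to the monomials with exponents `α` and `β`. -/
def monomialHom (α β : Fin 2 → ℕ) : MvPolynomial (Fin 2) k →ₐ[k] MvPolynomial (Fin 2) k :=
  aeval ![X 0 ^ α 0 * X 1 ^ α 1, X 0 ^ β 0 * X 1 ^ β 1]

lemma monomialHom_X_zero (α β : Fin 2 → ℕ) :
    monomialHom k α β (X 0) = X 0 ^ α 0 * X 1 ^ α 1 := by simp [monomialHom]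

lemma monomialHom_X_one (α β : Fin 2 → ℕ) :
    monomialHom k α β (X 1) = X 0 ^ β 0 * X 1 ^ β 1 := by simp [monomialHom]

/-- The exponents of a monomial in the `l`-th chart of the blowup of the origin. -/
def blowupExponent (l : Fin 2) (α : Fin 2 → ℕ) : Fin 2 → ℕ := Function.update α l (α 0 + α 1)

lemma blowupExponent_self (l : Fin 2) (α : Fin 2 → ℕ) : blowupExponent l α l = α 0 + α 1 := by
  simp [blowupExponent]

lemma blowupExponent_of_ne {l m : Fin 2} (h : l ≠ m) (α : Fin 2 → ℕ) :
    blowupExponent l α m = α m := by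
  simp [blowupExponent, h.symm]

lemma blowupHom_comp_monomialHom (l : Fin 2) (α β : Fin 2 → ℕ) :
    (blowupHom k l).comp (monomialHom k α β) =
      monomialHom k (blowupExponent l α) (blowupExponent l β) := by
  ext j : 1
  fin_cases j <;> fin_cases l <;>
    simp [monomialHom, blowupHom, blowupExponent] <;> ring

end Monomial

namespace BlowupTower

variable {k : Type u} [Field k] (T : BlowupTower k)

/-- A chart of `X n` in which `x - 1` and `y` are the monomials with exponents `α` and `β`, and
the curves of the tower are coordinate axes. -/
structure IsMonomialChart (n : ℕ) (χ : Spec (AffinePlaneRing k) ⟶ T.X n) (α β : Fin 2 → ℕ) :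
    Prop where
  isOpenImmersion : IsOpenImmersion χ
  det : β 1 * α 0 = α 1 * β 0 + 1
  comp_toPlane : χ ≫ T.toPlane n =
    Spec.map (CommRingCat.ofHom (monomialHom k α β).toRingHom) ≫ centredChart k
  -- The condition `0 < β l` says that `y` vanishes on the axis. Two curves meeting in the chart
  -- therefore force both entries of `β` to be positive.
  curve : ∀ i, χ ⁻¹' T.curve i n = ∅ ∨ ∃ l, χ ⁻¹' T.curve i n = coordAxis k l ∧ 0 < β l
  curve_injective : ∀ i j, (χ ⁻¹' T.curve i n).Nonempty →
    χ ⁻¹' T.curve i n = χ ⁻¹' T.curve j n → i = j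
  eq_of_eq_zero : n = 0 → α = ![1, 0] ∧ β = ![0, 1]
  le_one : n ≤ 1 → ∀ l, β l ≤ 1
  -- Exponents change only when a chart is blown up, so an old chart lags behind the level `n`. The
  -- claim is restricted to charts that meet the newest curve.
  farey : 1 ≤ n → 0 < β 0 → (∀ m, 1 ≤ m → m < n → T.p m ∈ T.curve m m) →
    (χ ⁻¹' T.curve n n).Nonempty → FareyNeighbors n (α 1) (β 1) (α 0) (β 0)

variable {T}

/-- The point `[1 : 0 : 1]` on the plane. -/
abbrev basePoint (k : Type u) [Field k] : Plane k := centredChart k (origin k)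

namespace IsMonomialChart

variable {n : ℕ} {χ : Spec (AffinePlaneRing k) ⟶ T.X n} {α β : Fin 2 → ℕ}

lemma beta_one_pos (h : T.IsMonomialChart n χ α β) : 0 < β 1 :=
  Nat.pos_of_ne_zero fun h0 ↦ by have := h.det; simp [h0] at this

lemma toPlane_apply_eq_iff (h : T.IsMonomialChart n χ α β) (q : Spec (AffinePlaneRing k)) :
    T.toPlane n (χ q) = basePoint k ↔
      (.X 0 ^ α 0 * .X 1 ^ α 1 : MvPolynomial (Fin 2) k) ∈ q.asIdeal ∧
        (.X 0 ^ β 0 * .X 1 ^ β 1 : MvPolynomial (Fin 2) k) ∈ q.asIdeal := by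
  rw [← Scheme.Hom.comp_apply, h.comp_toPlane, Scheme.Hom.comp_apply,
    (centredChart k).isOpenEmbedding.injective.eq_iff, ← monomialHom_X_zero α β,
    ← monomialHom_X_one α β]
  refine ⟨fun e ↦ ?_, fun ⟨h0, h1⟩ ↦ eq_origin h0 h1⟩
  have e' (l : Fin 2) : (.X l : MvPolynomial (Fin 2) k) ∈ (Spec.map (CommRingCat.ofHom
      (monomialHom k α β).toRingHom) q).asIdeal := by rw [e]; exact X_mem_origin l
  exact ⟨e' 0, e' 1⟩

end IsMonomialChart

lemma isMonomialChart_zero (T : BlowupTower k) :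
    T.IsMonomialChart 0 (centredChart k ≫ T.base.inv) ![1, 0] ![0, 1] := by
  have h0 : (centredChart k ≫ T.base.inv) ⁻¹' T.curve 0 0 = coordAxis k 1 := by
    ext q
    have : (centredChart k ≫ T.base.inv) q ∈ T.curve 0 0 ↔
        ((centredChart k ≫ T.base.inv) ≫ T.base.hom) q ∈ coordLine k 1 := by
      rw [Scheme.Hom.comp_apply _ T.base.hom]; simp [curve]
    rw [Set.mem_preimage, this, Category.assoc, Iso.inv_hom_id, Category.comp_id,
      centredChart_mem_coordLine_iff]
    rfl
  have hne (i : ℕ) (hi : i ≠ 0) : (centredChart k ≫ T.base.inv) ⁻¹' T.curve i 0 = ∅ := by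
    simp [curve, hi]
  have hid : monomialHom k ![1, 0] ![0, 1] = AlgHom.id k _ := by
    ext j : 1
    fin_cases j <;> simp [monomialHom]
  refine ⟨inferInstance, rfl, ?_, fun i ↦ ?_, fun i j ⟨q, hq⟩ e ↦ ?_, fun _ ↦ ⟨rfl, rfl⟩,
    fun _ l ↦ ?_, fun h ↦ absurd h (by simp)⟩
  · rw [hid]
    change _ = Spec.map (𝟙 _) ≫ _
    simp [toPlane]
  · rcases eq_or_ne i 0 with rfl | hi
    · exact .inr ⟨1, h0, Nat.one_pos⟩
    · exact .inl (hne i hi)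
  · have hi : i = 0 := by
      by_contra hi; rw [hne i hi] at hq; exact hq
    have hj : j = 0 := by
      by_contra hj; rw [e, hne j hj] at hq; exact hq
    rw [hi, hj]
  · fin_cases l <;> simp

section Admissible

variable {N : ℕ} (hT : T.IsAdmissible N)

include hT

lemma IsAdmissible.base_center : T.base.hom (T.p 0) = basePoint k :=
  eq_centredChart_origin _ hT.first_center

lemma IsAdmissible.closure_center {n : ℕ} (hn : n < N) : closure {T.p n} = {T.p n} :=
  (hT.isClosed_center n hn).closure_eq

lemma IsAdmissible.isClosed_basePoint (hN : 0 < N) : IsClosed {basePoint k} := by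
  rw [← hT.base_center]
  have := (Scheme.homeoOfIso T.base).isClosedMap _ (hT.isClosed_center 0 hN)
  rwa [Set.image_singleton] at this

/-- Of the two curves through a later centre, the one of larger index is exceptional, so only the
line `L` can fail to lie over the base point. -/
lemma IsAdmissible.toPlane_center_of_curve_subset {n : ℕ} (hn : n < N)
    (h : ∀ j, 1 ≤ j → T.curve j n ⊆ T.toPlane n ⁻¹' {basePoint k}) :
    T.toPlane n (T.p n) = basePoint k := by
  rcases Nat.eq_zero_or_pos n with rfl | hpos
  · exact hT.base_center
  · obtain ⟨i, j, hij, -, hmem⟩ := hT.mem_inter n hpos hn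
    exact h j (by omega) hmem.2

/-- By induction: the new curve lies over a centre that is over the base point, and the closures
that form strict transforms stay in the fibre because the base point is closed. Closedness comes
from the first centre, which needs `0 < N`. -/
lemma IsAdmissible.curve_subset {n : ℕ} (hn : n ≤ N) (hN : 0 < N) (j : ℕ) (hj : 1 ≤ j) :
    T.curve j n ⊆ T.toPlane n ⁻¹' {basePoint k} := by
  induction n generalizing j with
  | zero => simp [curve, show j ≠ 0 by omega]
  | succ n ih =>
    have hc := hT.toPlane_center_of_curve_subset hn (ih (by omega))
    have key (x) : T.toPlane (n + 1) x = T.toPlane n (T.π n x) := Scheme.Hom.comp_apply ..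
    by_cases h : j = n + 1
    · intro x hx
      rw [curve, if_pos h] at hx
      rw [Set.mem_preimage, key, show T.π n x = T.p n from hx]
      exact hc
    · rw [curve, if_neg h]
      refine closure_minimal ?_ ((hT.isClosed_basePoint hN).preimage (T.toPlane (n + 1)).continuous)
      intro x hx
      rw [Set.mem_preimage, key]
      exact ih (by omega) j hj hx.1

/-- All centres lie over the point `[1 : 0 : 1]`. -/
lemma IsAdmissible.toPlane_center {n : ℕ} (hn : n < N) : T.toPlane n (T.p n) = basePoint k :=
  hT.toPlane_center_of_curve_subset hn (hT.curve_subset hn.le (by omega))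

lemma IsAdmissible.comap_center_eq_top {n : ℕ} (hn : n < N) {V : Scheme.{u}} (χ : V ⟶ T.X n)
    (h : T.p n ∉ Set.range χ) : (T.center n).comap χ = ⊤ := by
  rw [← support_eq_bot_iff, support_comap, eq_bot_iff]
  intro x hx
  refine h ⟨x, ?_⟩
  have hx' : χ x ∈ ((T.center n).support : Set (T.X n)) := hx
  rw [center, coe_support_vanishingIdeal] at hx'
  simpa [hT.closure_center hn] using hx'

/-- The complement of the point `[1 : 0 : 1]` is an open subscheme of every `X n`. -/
lemma IsAdmissible.exists_lift_compl {n : ℕ} (hn : n ≤ N) (V : (Plane k).Opens)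
    (hV : basePoint k ∉ V) : ∃ χ : V.toScheme ⟶ T.X n, IsOpenImmersion χ ∧
      χ ≫ T.toPlane n = V.ι ∧ ∀ x, T.toPlane n x ∈ V → x ∈ Set.range χ := by
  induction n with
  | zero =>
    refine ⟨V.ι ≫ T.base.inv, inferInstance, by simp [toPlane], fun x hx ↦ ?_⟩
    obtain ⟨v, hv⟩ : T.base.hom x ∈ Set.range V.ι := by rw [Scheme.Opens.range_ι]; exact hx
    exact ⟨v, by rw [Scheme.Hom.comp_apply, hv]; simp⟩
  | succ n ih =>
    obtain ⟨χ, hχ, e, hr⟩ := ih (by omega)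
    have htop : (T.center n).comap χ = ⊤ := by
      refine hT.comap_center_eq_top hn χ ?_
      rintro ⟨v, hv⟩
      have := hT.toPlane_center hn
      rw [← hv, ← Scheme.Hom.comp_apply, e] at this
      exact hV (this ▸ v.2)
    obtain ⟨χ', hχ', e', hr'⟩ := (hT.isBlowup n hn).exists_lift_of_comap_eq_top χ htop
    refine ⟨χ', hχ', ?_, fun x hx ↦ hr' x (hr _ ?_)⟩
    · rw [← e, ← e', Category.assoc]; rfl
    · rwa [← Scheme.Hom.comp_apply]

end Admissible

namespace IsMonomialChart

variable {n : ℕ} {χ : Spec (AffinePlaneRing k) ⟶ T.X n} {α β : Fin 2 → ℕ}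

variable {N : ℕ}

/-- A centre in a monomial chart is the origin, and the axis `X 0 = 0` lies over the line `L`,
unless the chart is one of the plane. -/
lemma center_eq_origin (h : T.IsMonomialChart n χ α β) (hT : T.IsAdmissible N) (hn : n < N)
    {q : Spec (AffinePlaneRing k)} (hq : χ q = T.p n) :
    q = origin k ∧ (1 ≤ n → 0 < β 0) := by
  rcases Nat.eq_zero_or_pos n with rfl | hpos
  · refine ⟨?_, fun h ↦ absurd h (by simp)⟩
    have h1 := (h.toPlane_apply_eq_iff q).1 (hq ▸ hT.toPlane_center hn)
    obtain ⟨rfl, rfl⟩ := h.eq_of_eq_zero rfl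
    exact eq_origin (by simpa using h1.1) (by simpa using h1.2)
  · obtain ⟨i, j, hij, -, hi, hj⟩ := hT.mem_inter n hpos hn
    rw [← hq] at hi hj
    rcases h.curve i with h1 | ⟨l, h1, hl⟩
    · exact absurd (show q ∈ χ ⁻¹' T.curve i n from hi) (by rw [h1]; exact Set.notMem_empty q)
    rcases h.curve j with h2 | ⟨m, h2, hm⟩
    · exact absurd (show q ∈ χ ⁻¹' T.curve j n from hj) (by rw [h2]; exact Set.notMem_empty q)
    -- Distinct curves lie on distinct axes, so their common point is the origin, and one of the two
    -- axes is `X 0 = 0`, whence `0 < β 0`.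
    have hlm : l ≠ m := by
      rintro rfl
      exact hij.ne (h.curve_injective i j ⟨q, hi⟩ (h1.trans h2.symm))
    have hq1 : q ∈ coordAxis k l := h1 ▸ hi
    have hq2 : q ∈ coordAxis k m := h2 ▸ hj
    refine ⟨eq_origin_of_ne hlm hq1 hq2, fun _ ↦ ?_⟩
    rcases fin_two_ne_cases hlm with ⟨rfl, rfl⟩ | ⟨rfl, rfl⟩
    exacts [hl, hm]

lemma pull_center (h : T.IsMonomialChart n χ α β) (hT : T.IsAdmissible N) (hn : n < N)
    (hp : χ (origin k) = T.p n) :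
    (T.center n).pull χ = (Ideal.span {.X 0, .X 1} : Ideal (MvPolynomial (Fin 2) k)) := by
  have := h.isOpenImmersion
  rw [← origin_asIdeal]
  refine pull_vanishingIdeal_eq_of_iff _ _ (isPrime_asIdeal _).isRadical fun q ↦ ?_
  change χ q ∈ closure {T.p n} ↔ _
  rw [hT.closure_center hn, Set.mem_singleton_iff, ← hp, χ.isOpenEmbedding.injective.eq_iff]
  refine ⟨fun e ↦ e ▸ le_rfl, fun hle ↦ ?_⟩
  exact eq_origin (hle (X_mem_origin 0)) (hle (X_mem_origin 1))

lemma isClosed_preimage_curve (h : T.IsMonomialChart n χ α β) (i : ℕ) :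
    IsClosed (χ ⁻¹' T.curve i n) := by
  rcases h.curve i with h | ⟨l, h, -⟩ <;> rw [h]
  exacts [isClosed_empty, isClosed_coordAxis l]

/-- Preimage under an open continuous map commutes with closure, so a strict transform can be
computed inside a chart. -/
lemma _root_.BlowupTower.preimage_curve_succ {V : Scheme.{u}} (ψ : V ⟶ T.X (n + 1))
    [IsOpenImmersion ψ] {i : ℕ} (hi : i ≠ n + 1) :
    ψ ⁻¹' T.curve i (n + 1) = closure ((ψ ≫ T.π n) ⁻¹' (T.curve i n \ {T.p n})) := by
  rw [BlowupTower.curve, if_neg hi, ψ.isOpenEmbedding.isOpenMap.preimage_closure_eq_closure_preimage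
    ψ.continuous, ← Set.preimage_comp]
  rfl

lemma _root_.BlowupTower.preimage_curve_succ_self {V : Scheme.{u}} (ψ : V ⟶ T.X (n + 1)) :
    ψ ⁻¹' T.curve (n + 1) (n + 1) = (ψ ≫ T.π n) ⁻¹' {T.p n} := by
  rw [BlowupTower.curve, if_pos rfl, ← Set.preimage_comp]
  rfl

/-- A monomial chart that misses the centre is a monomial chart of the blowup. -/
lemma lift (h : T.IsMonomialChart n χ α β) {ψ : Spec (AffinePlaneRing k) ⟶ T.X (n + 1)}
    [IsOpenImmersion ψ] (hψ : ψ ≫ T.π n = χ) (hp : T.p n ∉ Set.range χ) :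
    T.IsMonomialChart (n + 1) ψ α β := by
  have hself : ψ ⁻¹' T.curve (n + 1) (n + 1) = ∅ := by
    rw [preimage_curve_succ_self, hψ, Set.preimage_singleton_eq_empty]
    exact hp
  have hne {i : ℕ} (hi : i ≠ n + 1) : ψ ⁻¹' T.curve i (n + 1) = χ ⁻¹' T.curve i n := by
    rw [preimage_curve_succ ψ hi, hψ, Set.preimage_sdiff, Set.preimage_singleton_eq_empty.2 hp,
      Set.sdiff_empty, (h.isClosed_preimage_curve i).closure_eq]
  have hne' {i : ℕ} (hi : (ψ ⁻¹' T.curve i (n + 1)).Nonempty) : i ≠ n + 1 := by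
    rintro rfl
    exact hi.ne_empty hself
  -- The assertion about Farey neighbours is vacuous here, since a lifted chart does not meet the
  -- new exceptional curve.
  refine ⟨inferInstance, h.det, ?_, fun i ↦ ?_, fun i j hi e ↦ ?_, fun h ↦ absurd h (by simp),
    fun hn ↦ h.le_one (by omega), fun _ _ _ hi ↦ absurd rfl (hne' hi)⟩
  · rw [← h.comp_toPlane, ← hψ, Category.assoc]; rfl
  · rcases eq_or_ne i (n + 1) with rfl | hi
    · exact .inl hself
    · rw [hne hi]; exact h.curve i
  · have hi' := hne' hi
    have hj' := hne' (e ▸ hi)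
    rw [hne hi'] at hi e
    rw [hne hj'] at e
    exact h.curve_injective i j hi e

/-- The standard charts of the blowup of the origin of a monomial chart are monomial charts. -/
lemma blowup (h : T.IsMonomialChart n χ α β) (hT : T.IsAdmissible N) (hn : n < N)
    (hp : χ (origin k) = T.p n) {l m : Fin 2} (hlm : l ≠ m)
    {ψ : Spec (AffinePlaneRing k) ⟶ T.X (n + 1)} [IsOpenImmersion ψ]
    (hψ : ψ ≫ T.π n = Spec.map (CommRingCat.ofHom (blowupHom k l).toRingHom) ≫ χ) :
    T.IsMonomialChart (n + 1) ψ (blowupExponent l α) (blowupExponent l β) := by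
  have hoi := h.isOpenImmersion
  have hinj := χ.isOpenEmbedding.injective
  have hl (q : Spec (AffinePlaneRing k)) : (MvPolynomial.X l : MvPolynomial (Fin 2) k) ∈
      (Spec.map (CommRingCat.ofHom (blowupHom k l).toRingHom) q).asIdeal ↔
        .X l ∈ q.asIdeal := by
    change blowupHom k l (.X l) ∈ q.asIdeal ↔ _
    rw [blowupHom_X_self]
  have hm (q : Spec (AffinePlaneRing k)) : (MvPolynomial.X m : MvPolynomial (Fin 2) k) ∈
      (Spec.map (CommRingCat.ofHom (blowupHom k l).toRingHom) q).asIdeal ↔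
        .X l ∈ q.asIdeal ∨ .X m ∈ q.asIdeal := by
    change blowupHom k l (.X m) ∈ q.asIdeal ↔ _
    rw [blowupHom_X_of_ne hlm]
    exact (isPrime_asIdeal q).mul_mem_iff_mem_or_mem
  -- The fibre of the substitution over the origin is the axis `X l = 0`, which becomes the
  -- exceptional curve.
  have horigin (q : Spec (AffinePlaneRing k)) :
      Spec.map (CommRingCat.ofHom (blowupHom k l).toRingHom) q = origin k ↔ q ∈ coordAxis k l := by
    refine ⟨fun e ↦ (hl q).1 (e ▸ X_mem_origin l), fun hq ↦ ?_⟩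
    exact eq_origin_of_ne hlm ((hl q).2 hq) ((hm q).2 (.inl hq))
  have hself : ψ ⁻¹' T.curve (n + 1) (n + 1) = coordAxis k l := by
    rw [preimage_curve_succ_self, hψ]
    ext q
    rw [Set.mem_preimage, Scheme.Hom.comp_apply, Set.mem_singleton_iff, ← hp, hinj.eq_iff,
      horigin]
  have hmem (i : ℕ) (q : Spec (AffinePlaneRing k)) :
      q ∈ (ψ ≫ T.π n) ⁻¹' (T.curve i n \ {T.p n}) ↔
        Spec.map (CommRingCat.ofHom (blowupHom k l).toRingHom) q ∈ χ ⁻¹' T.curve i n ∧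
          q ∉ coordAxis k l := by
    rw [hψ, Set.mem_preimage, Scheme.Hom.comp_apply, Set.mem_sdiff, Set.mem_singleton_iff, ← hp,
      hinj.eq_iff, horigin]
    rfl
  -- An old curve on the axis `X l = 0` has a strict transform that misses this chart; one on the
  -- axis `X m = 0` keeps that equation.
  have hne {i : ℕ} (hi : i ≠ n + 1) : ψ ⁻¹' T.curve i (n + 1) = ∅ ∨
      ψ ⁻¹' T.curve i (n + 1) = coordAxis k m ∧ χ ⁻¹' T.curve i n = coordAxis k m ∧ 0 < β m := by
    rw [preimage_curve_succ ψ hi, closure_empty_iff]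
    rcases h.curve i with h0 | ⟨j, hj, hpos⟩
    · refine .inl (Set.eq_empty_of_forall_notMem fun q hq ↦ ?_)
      rw [hmem, h0] at hq
      exact hq.1
    · rcases eq_or_eq_of_ne hlm j with rfl | rfl
      · refine .inl (Set.eq_empty_of_forall_notMem fun q hq ↦ ?_)
        rw [hmem, hj] at hq
        exact hq.2 ((hl q).1 hq.1)
      · refine .inr ⟨?_, hj, hpos⟩
        rw [← closure_coordAxis_diff hlm]
        congr 1
        ext q
        rw [hmem, hj]
        exact and_congr_left fun hq ↦ (hm q).trans (or_iff_right hq)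
  refine ⟨inferInstance, ?_, ?_, fun i ↦ ?_, fun i j hi e ↦ ?_, fun h ↦ absurd h (by simp),
    fun hn ↦ ?_, fun _ hpos hc _ ↦ ?_⟩
  · have := h.det
    rcases fin_two_ne_cases hlm with ⟨rfl, rfl⟩ | ⟨rfl, rfl⟩ <;>
      simp only [blowupExponent_self, blowupExponent_of_ne hlm] <;> nlinarith
  · rw [← blowupHom_comp_monomialHom, toPlane, ← Category.assoc, hψ, Category.assoc,
      h.comp_toPlane, ← Category.assoc, ← Spec.map_comp]
    rfl
  · rcases eq_or_ne i (n + 1) with rfl | hi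
    · refine .inr ⟨l, hself, ?_⟩
      rw [blowupExponent_self]
      exact Nat.add_pos_right _ h.beta_one_pos
    · rcases hne hi with h | ⟨h, -, hpos⟩
      · exact .inl h
      · exact .inr ⟨m, h, by rwa [blowupExponent_of_ne hlm]⟩
  · rcases eq_or_ne i (n + 1) with rfl | hi' <;> rcases eq_or_ne j (n + 1) with rfl | hj'
    · rfl
    · rw [hself] at hi e
      rcases hne hj' with h | ⟨h, -⟩
      · rw [e, h] at hi
        exact absurd hi Set.not_nonempty_empty
      · rw [h] at e
        exact absurd (coordAxis_injective e) hlm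
    · rw [hself] at e
      rcases hne hi' with h | ⟨h, -⟩
      · rw [h] at hi
        exact absurd hi Set.not_nonempty_empty
      · rw [h] at e
        exact absurd (coordAxis_injective e).symm hlm
    · rcases hne hi' with h1 | ⟨-, h1, -⟩
      · rw [h1] at hi
        exact absurd hi Set.not_nonempty_empty
      rcases hne hj' with h2 | ⟨-, h2, -⟩
      · rw [e, h2] at hi
        exact absurd hi Set.not_nonempty_empty
      exact h.curve_injective i j (h1 ▸ ⟨origin k, X_mem_origin m⟩) (h1.trans h2.symm)
  · obtain rfl : n = 0 := by omega
    obtain ⟨-, rfl⟩ := h.eq_of_eq_zero rfl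
    intro j
    fin_cases l <;> fin_cases j <;> simp [blowupExponent]
  · rcases Nat.eq_zero_or_pos n with rfl | hn1
    · obtain ⟨rfl, rfl⟩ := h.eq_of_eq_zero rfl
      rcases fin_two_ne_cases hlm with ⟨rfl, rfl⟩ | ⟨rfl, rfl⟩
      · exact FareyNeighbors.one
      -- In this chart of the first blowup `y = X 1` and `β 0 = 0`: the axis `X 0 = 0` is the strict
      -- transform of `x = 1`, which is not a curve of the tower.
      · simp [blowupExponent] at hpos
    -- The centre lies on the newest curve, so the chart being blown up meets it and already carries
    -- neighbours of level `n`. The chart for `X 0` replaces the right fraction by the mediant, the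
    -- chart for `X 1` the left one.
    · have hf := h.farey hn1 ((h.center_eq_origin hT hn hp).2 hn1)
        (fun m hm hmn ↦ hc m hm (by omega))
        ⟨origin k, by rw [Set.mem_preimage, hp]; exact hc n hn1 (by omega)⟩
      rcases fin_two_ne_cases hlm with ⟨rfl, rfl⟩ | ⟨rfl, rfl⟩ <;>
        simp only [blowupExponent_self, blowupExponent_of_ne hlm]
      · rw [add_comm (α 0), add_comm (β 0)]
        exact hf.mediant_right hn1
      · rw [add_comm (α 0), add_comm (β 0)]
        exact hf.mediant_left hn1

/-- Near a point over a chart at whose origin one blows up, the blowup is covered by the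
standard charts. -/
lemma exists_blowup (h : T.IsMonomialChart n χ α β) (hT : T.IsAdmissible N) (hn : n < N)
    (hp : χ (origin k) = T.p n) (x : T.X (n + 1)) (hx : T.π n x ∈ Set.range χ) :
    ∃ (l m : Fin 2) (_ : l ≠ m) (ψ : Spec (AffinePlaneRing k) ⟶ T.X (n + 1)), IsOpenImmersion ψ ∧
      ψ ≫ T.π n = Spec.map (CommRingCat.ofHom (blowupHom k l).toRingHom) ≫ χ ∧
      x ∈ Set.range ψ := by
  have hoi := h.isOpenImmersion
  have hI := h.pull_center hT hn hp
  have hb := hT.isBlowup n hn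
  have key {l m : Fin 2} (hlm : l ≠ m) (hx : IsBlowup.IsGeneratedNear (T.π n) χ
      (R := AffinePlaneRing k) (.X l : MvPolynomial (Fin 2) k) (.X m : MvPolynomial (Fin 2) k) x) :
      ∃ ψ : Spec (AffinePlaneRing k) ⟶ T.X (n + 1), IsOpenImmersion ψ ∧
        ψ ≫ T.π n = Spec.map (CommRingCat.ofHom (blowupHom k l).toRingHom) ≫ χ ∧
        x ∈ Set.range ψ := by
    have hI' : (T.center n).pull χ =
        (Ideal.span {.X l, .X m} : Ideal (MvPolynomial (Fin 2) k)) := by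
      rcases fin_two_ne_cases hlm with ⟨rfl, rfl⟩ | ⟨rfl, rfl⟩
      · exact hI
      · rw [Set.pair_comm]; exact hI
    have : IsDomain (AffinePlaneRing k) := inferInstanceAs (IsDomain (MvPolynomial (Fin 2) k))
    obtain ⟨ψ, h1, h2, h3⟩ := hb.exists_chart (R' := AffinePlaneRing k)
      (CommRingCat.ofHom (blowupHom k l).toRingHom) (MvPolynomial.X m : MvPolynomial (Fin 2) k)
      hI' (by
        change blowupHom k l (.X l) ≠ 0
        rw [blowupHom_X_self]; exact X_ne_zero l)
      (by
        change blowupHom k l (.X m) = blowupHom k l (.X l) * .X m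
        rw [blowupHom_X_self, blowupHom_X_of_ne hlm])
      (fun S φ t ht ↦ by
        obtain ⟨φ', h1, h2⟩ := exists_ringHom_factor hlm φ.hom t ht
        exact ⟨CommRingCat.ofHom φ', by ext1; exact h1, h2⟩)
      (fun S f g e hm ↦ by
        ext1
        exact ringHom_ext_blowupHom hlm f.hom g.hom (congrArg CommRingCat.Hom.hom e) hm)
    exact ⟨ψ, h1, h2, h3 x hx⟩
  rcases hb.isGeneratedNear_or hI x hx with hx | hx
  · exact ⟨0, 1, by decide, key (by decide) hx⟩
  · exact ⟨1, 0, by decide, key (by decide) hx⟩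

end IsMonomialChart

/-- The points over `[1 : 0 : 1]` are covered by monomial charts. -/
lemma IsAdmissible.exists_isMonomialChart {N : ℕ} (hT : T.IsAdmissible N) {n : ℕ} (hn : n ≤ N)
    (x : T.X n) (hx : T.toPlane n x = basePoint k) :
    ∃ χ α β, T.IsMonomialChart n χ α β ∧ x ∈ Set.range χ := by
  induction n with
  | zero =>
    refine ⟨_, _, _, isMonomialChart_zero T, origin k, ?_⟩
    rw [Scheme.Hom.comp_apply, ← basePoint, ← hx]
    simp [toPlane]
  | succ n ih =>
    obtain ⟨χ, α, β, h, hr⟩ := ih (by omega) (T.π n x) (by rwa [← Scheme.Hom.comp_apply])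
    have := h.isOpenImmersion
    by_cases hp : T.p n ∈ Set.range χ
    · obtain ⟨q, hq⟩ := hp
      obtain rfl := (h.center_eq_origin hT hn hq).1
      obtain ⟨l, m, hlm, ψ, hψ, e, hxψ⟩ := h.exists_blowup hT hn hq x hr
      exact ⟨ψ, _, _, h.blowup hT hn hq hlm e, hxψ⟩
    · obtain ⟨ψ, hψ, e, hr'⟩ := (hT.isBlowup n hn).exists_lift_of_comap_eq_top χ
        (hT.comap_center_eq_top hn χ hp)
      exact ⟨ψ, _, _, h.lift e hp, hr' x hr⟩

end BlowupTower

end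

/-! ### Part (ii): the coordinates of a monomial chart as fractions in `x - 1` and `y`. -/

section

open MvPolynomial Scheme.IdealSheafData

lemma AlgebraicGeometry.Scheme.Hom.comp_appLE_top {X Y Z : Scheme.{u}} (f : X ⟶ Y) (g : Y ⟶ Z)
    (U : Z.Opens) (e : ⊤ ≤ (f ≫ g) ⁻¹ᵁ U) (e' : ⊤ ≤ g ⁻¹ᵁ U) :
    (f ≫ g).appLE U ⊤ e = g.appLE U ⊤ e' ≫ f.appTop := by
  rw [show f.appTop = f.appLE ⊤ ⊤ le_rfl from (Scheme.Hom.appLE_eq_app _).symm]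
  exact (Scheme.Hom.appLE_comp_appLE ..).symm

/-- The fractions that equal the coordinates of a monomial chart. -/
lemma fraction_equations {k : Type*} [Field k] {S : Type*} [CommRing S]
    (e : S ≃+* MvPolynomial (Fin 2) k) {α β : Fin 2 → ℕ} (det : β 1 * α 0 = α 1 * β 0 + 1)
    {x y : S} (hx : e x = 1 + X 0 ^ α 0 * X 1 ^ α 1) (hy : e y = X 0 ^ β 0 * X 1 ^ β 1) :
    x - 1 ∈ nonZeroDivisors S ∧ y ∈ nonZeroDivisors S ∧
      e.symm (X 0) * y ^ α 1 = (x - 1) ^ β 1 ∧ e.symm (X 1) * (x - 1) ^ β 0 = y ^ α 0 := by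
  have : IsDomain S := e.toMulEquiv.isDomain (MvPolynomial (Fin 2) k)
  have hu : e (x - 1) = X 0 ^ α 0 * X 1 ^ α 1 := by
    rw [map_sub, map_one, hx, add_sub_cancel_left]
  have h0 (γ : Fin 2 → ℕ) : (X 0 ^ γ 0 * X 1 ^ γ 1 : MvPolynomial (Fin 2) k) ≠ 0 :=
    mul_ne_zero (pow_ne_zero _ (X_ne_zero 0)) (pow_ne_zero _ (X_ne_zero 1))
  refine ⟨mem_nonZeroDivisors_of_ne_zero fun h ↦ h0 α ?_,
    mem_nonZeroDivisors_of_ne_zero fun h ↦ h0 β ?_, e.injective ?_, e.injective ?_⟩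
  · rw [← hu, h, map_zero]
  · rw [← hy, h, map_zero]
  -- On both sides the exponent of `X 1` is `α 1 * β 1`, and those of `X 0` agree by the determinant
  -- condition. The second equation is symmetric.
  · rw [map_mul, map_pow, map_pow, hu, hy, e.apply_symm_apply, mul_pow, mul_pow, ← pow_mul,
      ← pow_mul, ← pow_mul, ← pow_mul, ← mul_assoc, ← pow_succ', mul_comm (α 0), det,
      mul_comm (β 0), mul_comm (β 1)]
  · rw [map_mul, map_pow, map_pow, hu, hy, e.apply_symm_apply, mul_pow, mul_pow, ← pow_mul,
      ← pow_mul, ← pow_mul, ← pow_mul, mul_left_comm, ← pow_succ', ← det, mul_comm (β 0)]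

namespace BlowupTower

variable {k : Type u} [Field k] {T : BlowupTower k} {n : ℕ}
  {χ : Spec (AffinePlaneRing k) ⟶ T.X n} {α β : Fin 2 → ℕ}

/-! ### Generators of the ideal of a centre -/

namespace IsMonomialChart

lemma opensRange_le (h : T.IsMonomialChart n χ α β) [IsOpenImmersion χ] :
    χ.opensRange ≤ T.toPlane n ⁻¹ᵁ chartZ k := by
  rintro _ ⟨q, rfl⟩
  change T.toPlane n (χ q) ∈ chartZ k
  rw [← opensRange_centredChart, ← Scheme.Hom.comp_apply, h.comp_toPlane, Scheme.Hom.comp_apply]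
  exact ⟨_, rfl⟩

/-- Transports the coordinates of the plane to the chart along `comp_toPlane`; for `x` and `y` the
right-hand side is `1 + X 0 ^ α 0 * X 1 ^ α 1` and `X 0 ^ β 0 * X 1 ^ β 1`. -/
lemma sectionsIso_affineCoord (h : T.IsMonomialChart n χ α β) [IsOpenImmersion χ] (i : Fin 3) :
    (sectionsIso χ).hom.hom (((T.toPlane n).appLE (chartZ k) χ.opensRange h.opensRange_le).hom
      (affineCoord k i)) =
    monomialHom k α β (translation k (dehomogenize k 2 (.X i))) := by
  have e1 : ⊤ ≤ centredChart k ⁻¹ᵁ chartZ k := by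
    rw [← opensRange_centredChart]; exact fun x _ ↦ ⟨x, rfl⟩
  have key (f : Spec (AffinePlaneRing k) ⟶ Plane k) (hf : f = Spec.map (CommRingCat.ofHom
      (monomialHom k α β).toRingHom) ≫ centredChart k) (e : ⊤ ≤ f ⁻¹ᵁ chartZ k) :
      f.appLE (chartZ k) ⊤ e = (centredChart k).appLE (chartZ k) ⊤ e1 ≫
        (Spec.map (CommRingCat.ofHom (monomialHom k α β).toRingHom)).appTop := by
    subst hf
    exact Scheme.Hom.comp_appLE_top ..
  have h1 : (T.toPlane n).appLE (chartZ k) χ.opensRange h.opensRange_le ≫ (sectionsIso χ).hom =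
      (centredChart k).appLE (chartZ k) ⊤ e1 ≫ (Scheme.ΓSpecIso (AffinePlaneRing k)).hom ≫
        CommRingCat.ofHom (monomialHom k α β).toRingHom := by
    rw [sectionsIso_hom, ← Category.assoc, Scheme.Hom.appLE_comp_appLE, key _ h.comp_toPlane,
      Category.assoc, Scheme.ΓSpecIso_naturality]
  rw [← RingHom.comp_apply, ← CommRingCat.hom_comp, h1, CommRingCat.hom_comp, RingHom.comp_apply,
    appLE_affineCoord, CommRingCat.hom_comp, RingHom.comp_apply,
    ← RingHom.comp_apply _ _ (translation _ _), ← CommRingCat.hom_comp, Iso.inv_hom_id,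
    CommRingCat.hom_id, RingHom.id_apply]
  rfl

/-- The centre is the origin, its ideal is generated by the two coordinates of the chart, and these
are the required fractions by `fraction_equations`. -/
lemma isLocallyDefinedBy {N : ℕ} (h : T.IsMonomialChart n χ α β) (hT : T.IsAdmissible N)
    (hn : n < N) (hp : χ (origin k) = T.p n) :
    T.IsLocallyDefinedBy n (T.center n) (α 1) (β 1) (α 0) (β 0) := by
  have hoi := h.isOpenImmersion
  let e : Γ(T.X n, χ.opensRange) ≃+* MvPolynomial (Fin 2) k :=
    (sectionsIso χ).commRingCatIsoToRingEquiv
  have hx := h.sectionsIso_affineCoord 0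
  have hy := h.sectionsIso_affineCoord 1
  rw [dehomogenize_two_X_zero, translation_X_zero, map_add, map_one, monomialHom_X_zero] at hx
  rw [dehomogenize_two_X_one, translation_X_one, monomialHom_X_one] at hy
  obtain ⟨h1, h2, h3, h4⟩ := fraction_equations e h.det hx hy
  refine ⟨⟨χ.opensRange, isAffineOpen_opensRange χ⟩, h.opensRange_le, ⟨_, hp⟩, _, _,
    e.symm (.X 0), e.symm (.X 1), rfl, rfl, h1, h2, h3, h4, ?_⟩
  rw [ideal_eq_comap, h.pull_center hT hn hp]
  refine Eq.trans (Ideal.map_symm (f := e)).symm ?_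
  rw [Ideal.map_span, Set.image_pair]

end IsMonomialChart

lemma IsAdmissible.exists_isLocallyDefinedBy {N : ℕ} (hT : T.IsAdmissible N)
    (h : ∀ n, 1 ≤ n → n < N → T.p n ∈ T.curve n n) (hn1 : 1 ≤ n) (hn : n < N) :
    ∃ a b c d : ℕ, FareyNeighbors n a b c d ∧ IsBlowup (T.π n) (T.center n) ∧
      T.IsLocallyDefinedBy n (T.center n) a b c d := by
  obtain ⟨χ, α, β, hχ, q, hq⟩ := hT.exists_isMonomialChart hn.le _ (hT.toPlane_center hn)
  obtain ⟨rfl, hpos⟩ := hχ.center_eq_origin hT hn hq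
  refine ⟨_, _, _, _, hχ.farey hn1 (hpos hn1) (fun m h1 h2 ↦ h m h1 (by omega)) ⟨origin k, ?_⟩,
    hT.isBlowup n hn, hχ.isLocallyDefinedBy hT hn hq⟩
  rw [Set.mem_preimage, hq]
  exact h n hn1 hn

end BlowupTower

end

/-! ### Part (i): coordinate divisors, the largest divisor and its formula. -/

section

open MvPolynomial Scheme.IdealSheafData

/-- The local ring of `S` at a prime is the local ring of `R` at the contracted prime. -/
lemma IsRegularRing.of_isLocalization {R : Type*} (S : Type*) [CommRing R] [CommRing S]
    [Algebra R S] (M : Submonoid R) [IsLocalization M S] [IsRegularRing R] : IsRegularRing S := by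
  have : IsNoetherianRing S := IsLocalization.isNoetherianRing M S inferInstance
  refine ⟨fun q hq ↦ ?_⟩
  have := IsLocalization.isLocalization_isLocalization_atPrime_isLocalization M
    (Localization.AtPrime q) q
  exact IsRegularLocalRing.of_ringEquiv (IsLocalization.algEquiv (q.under R).primeCompl
    (Localization.AtPrime (q.under R)) (Localization.AtPrime q)).toRingEquiv

section CoordinateDivisor

variable {k : Type u} [Field k] {Y : Scheme.{u}} {D : Y.IdealSheafData}

variable (k) in
/-- Near `x`, the scheme is an open part of the affine plane over `k`, on which the divisor is a
sum of coordinate axes. -/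
def IsCoordinateDivisorAt (D : Y.IdealSheafData) (x : Y) : Prop :=
  ∃ (r : MvPolynomial (Fin 2) k) (ε : Fin 2 → ℕ)
    (χ : Spec (CommRingCat.of (Localization.Away r)) ⟶ Y), IsOpenImmersion χ ∧ x ∈ Set.range χ ∧
    (∀ l, ε l ≤ 1) ∧ D.pull χ = (Ideal.span {MvPolynomial.X 0 ^ ε 0 * MvPolynomial.X 1 ^ ε 1}).map
      (algebraMap (MvPolynomial (Fin 2) k) (Localization.Away r))

lemma IsCoordinateDivisorAt.isEffectiveCartier (h : ∀ x, IsCoordinateDivisorAt k D x) :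
    IsEffectiveCartier D := by
  refine isEffectiveCartier_of_pull fun x ↦ ?_
  obtain ⟨r, ε, χ, hχ, hx, -, hD⟩ := h x
  refine ⟨_, χ, hχ, hx, _, ?_, hD.trans (by rw [Ideal.map_span, Set.image_singleton])⟩
  exact IsLocalization.map_nonZeroDivisors_le (Submonoid.powers r) _
    (Submonoid.mem_map_of_mem _ (mem_nonZeroDivisors_of_ne_zero
      (mul_ne_zero (pow_ne_zero _ (X_ne_zero 0)) (pow_ne_zero _ (X_ne_zero 1)))))

lemma IsCoordinateDivisorAt.radical_eq (h : ∀ x, IsCoordinateDivisorAt k D x) :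
    D.radical = D := by
  refine ext_of_pull fun x ↦ ?_
  obtain ⟨r, ε, χ, hχ, hx, hε, hD⟩ := h x
  refine ⟨_, χ, hχ, hx, ?_⟩
  rw [pull_radical, hD]
  refine (IsLocalization.map_radical (Submonoid.powers r) _ _).symm.trans ?_
  rw [isRadical_span_monomial (hε 0) (hε 1)]

lemma IsCoordinateDivisorAt.isStrictNormalCrossings (h : ∀ x, IsCoordinateDivisorAt k D x) :
    IsStrictNormalCrossings D := by
  intro x hx
  obtain ⟨r, ε, χ, hχ, ⟨q, rfl⟩, hε, hD⟩ := h x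
  have : IsRegularRing (Localization.Away r) :=
    IsRegularRing.of_isLocalization _ (Submonoid.powers r)
  let φ := algebraMap (MvPolynomial (Fin 2) k) (Localization.Away r)
  have hq' : (show Ideal (Localization.Away r) from q.asIdeal).IsPrime := PrimeSpectrum.isPrime q
  have hq : (q.asIdeal.comap φ).IsPrime := Ideal.IsPrime.comap _
  have hmem : (MvPolynomial.X 0 ^ ε 0 * MvPolynomial.X 1 ^ ε 1) ∈ q.asIdeal.comap φ := by
    have := (mem_support_iff_pull_le D χ q).1 hx
    rw [hD] at this
    exact Ideal.map_le_iff_le_comap.1 this (Ideal.mem_span_singleton_self _)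
  obtain ⟨d, t, s, w, hd, ht, hw, e⟩ := exists_parameters_of_mem (w := 1) hε
    ((Ideal.ne_top_iff_one _).1 hq.ne_top) hmem
  refine exists_regular_parameters_of_pull χ q (f := φ (MvPolynomial.X 0 ^ ε 0 *
    MvPolynomial.X 1 ^ ε 1)) ?_ (fun i ↦ φ (t i)) s ?_ ?_ (w := φ w) hw ?_
  · rw [hD, Ideal.map_span, Set.image_singleton]
  · rw [← hd]
    exact (IsLocalization.height_under (Submonoid.powers r) q.asIdeal).symm
  · rw [← IsLocalization.map_under (Submonoid.powers r) (Localization.Away r) q.asIdeal]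
    refine Eq.trans ?_ (congrArg (Ideal.map φ) ht)
    rw [Ideal.map_span, ← Set.range_comp]
    rfl
  · rw [← map_prod, ← map_mul, ← e, one_mul]

lemma IsCoordinateDivisorAt.isNormalCrossings (h : ∀ x, IsCoordinateDivisorAt k D x) :
    IsNormalCrossings D where
  cartier := isEffectiveCartier h
  reduced := radical_eq h
  locally_strict x := ⟨Y, 𝟙 Y, inferInstance, ⟨x, rfl⟩, by
    rw [Scheme.IdealSheafData.comap_id]; exact isStrictNormalCrossings h⟩

lemma comap_eq_of_pull_eq {X : Scheme.{u}} {R : CommRingCat.{u}} {I J : X.IdealSheafData}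
    {χ : Spec R ⟶ X} (h : I.pull χ = J.pull χ) : I.comap χ = J.comap χ := by
  have key (I : X.IdealSheafData) : (I.comap χ).pull (𝟙 _) = I.pull χ := by
    rw [pull_comap, Category.id_comp]
  exact le_antisymm (pull_id_le_iff.1 (by rw [key, key, h]))
    (pull_id_le_iff.1 (by rw [key, key, h]))

/-- The total transform of the two axes under the blowup of the origin. -/
lemma map_blowupHom_span_mul {l m : Fin 2} (hlm : l ≠ m) :
    (Ideal.span {X 0 * X 1}).map (blowupHom k l).toRingHom =
      Ideal.span {(X 0 * X 1 : MvPolynomial (Fin 2) k)} *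
        (Ideal.span {X 0, X 1}).map (blowupHom k l).toRingHom := by
  have h : (Ideal.span {X 0, X 1}).map (blowupHom k l).toRingHom =
      Ideal.span {(X l : MvPolynomial (Fin 2) k)} := by
    have h1 : ({X 0, X 1} : Set (MvPolynomial (Fin 2) k)) = {X l, X m} := by
      rcases fin_two_ne_cases hlm with ⟨rfl, rfl⟩ | ⟨rfl, rfl⟩
      exacts [rfl, Set.pair_comm _ _]
    rw [h1, Ideal.map_span, Set.image_pair]
    change Ideal.span {blowupHom k l (X l), blowupHom k l (X m)} = _
    rw [blowupHom_X_self, blowupHom_X_of_ne hlm]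
    refine le_antisymm ?_ (Ideal.span_mono (by simp))
    rw [Ideal.span_le]
    rintro _ (rfl | rfl)
    exacts [Ideal.mem_span_singleton_self _, Ideal.mem_span_singleton.2 (dvd_mul_right _ _)]
  have h2 : (X 0 * X 1 : MvPolynomial (Fin 2) k) = X l * X m := by
    rcases fin_two_ne_cases hlm with ⟨rfl, rfl⟩ | ⟨rfl, rfl⟩
    exacts [rfl, mul_comm _ _]
  rw [h, h2, Ideal.map_span, Set.image_singleton, Ideal.span_singleton_mul_span_singleton]
  change Ideal.span {blowupHom k l (X l * X m)} = _
  rw [map_mul, blowupHom_X_self, blowupHom_X_of_ne hlm, mul_right_comm, mul_assoc, mul_comm]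

/-- The line with index `j` misses the chart, and the other two lines are its axes. -/
lemma pull_triangle (j : Fin 3) : (triangle k).pull (planeChart k j) =
    (Ideal.span {MvPolynomial.X 0 * MvPolynomial.X 1} : Ideal (MvPolynomial (Fin 2) k)) := by
  have h (i : Fin 3) := pull_coordLine (k := k) j i
  have hp (a b c : (Plane k).IdealSheafData) : (a * (b * c)).pull (planeChart k j) =
      a.pull (planeChart k j) * (b.pull (planeChart k j) * c.pull (planeChart k j)) := by
    rw [pull_mul, pull_mul]
  rw [triangle, Fin.prod_univ_succAbove _ j, Fin.prod_univ_two, hp, h, h, h,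
    dehomogenize_X_self, dehomogenize_X_succAbove, dehomogenize_X_succAbove,
    Ideal.span_singleton_one, Ideal.top_mul, Ideal.span_singleton_mul_span_singleton]

end CoordinateDivisor

namespace BlowupTower

variable {k : Type u} [Field k] {T : BlowupTower k} {n N : ℕ}

/-! ### The largest normal crossings divisor -/

variable (k) in
/-- The ideal sheaf of the lines `X = 0` and `Z = 0`. -/
def outerLines : (Plane k).IdealSheafData :=
  vanishingIdeal (coordLine k 0) * vanishingIdeal (coordLine k 2)

variable (k) in
lemma triangle_eq : triangle k = outerLines k * vanishingIdeal (coordLine k 1) := by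
  rw [triangle, Fin.prod_univ_three, outerLines, mul_right_comm]

variable (T n) in
/-- The ideal sheaf of the reduced preimage of the line `L`. -/
def reducedPreimage : (T.X n).IdealSheafData :=
  ((vanishingIdeal (coordLine k 1)).comap (T.toPlane n)).radical

variable (T n) in
/-- The ideal sheaf of the reduced preimage of the triangle. -/
def maxDivisor : (T.X n).IdealSheafData :=
  (outerLines k).comap (T.toPlane n) * T.reducedPreimage n

lemma support_maxDivisor : ((T.maxDivisor n).support : Set (T.X n)) =
    T.toPlane n ⁻¹' ((triangle k).support : Set (Plane k)) := by
  rw [maxDivisor, reducedPreimage, triangle_eq, support_mul, support_mul, support_radical,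
    support_comap, support_comap]
  rfl

/-- A competitor `J` is reduced, so it is the vanishing ideal of its support. That support lies in
the support of `maxDivisor`, which is the full preimage of the triangle, and this gives the
inclusion of ideals. -/
lemma isMaximalNormalCrossings_maxDivisor (h : ∀ x, IsCoordinateDivisorAt k (T.maxDivisor n) x) :
    T.IsMaximalNormalCrossings n (T.maxDivisor n) := by
  refine ⟨⟨IsCoordinateDivisorAt.isNormalCrossings h, ?_⟩, fun J hJ ↦ ?_⟩
  · rw [Set.image_subset_iff, support_maxDivisor]
  · rw [← hJ.1.reduced, ← vanishingIdeal_support, ← le_support_iff_le_vanishingIdeal,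
      ← SetLike.coe_subset_coe, support_maxDivisor, ← Set.image_subset_iff]
    exact hJ.2

lemma comap_toPlane_succ (I : (Plane k).IdealSheafData) :
    I.comap (T.toPlane (n + 1)) = (I.comap (T.toPlane n)).comap (T.π n) := comap_comp ..

namespace IsMonomialChart

variable {χ : Spec (AffinePlaneRing k) ⟶ T.X n} {α β : Fin 2 → ℕ}

lemma pull_comap_toPlane (h : T.IsMonomialChart n χ α β) (i : Fin 3) :
    ((vanishingIdeal (coordLine k i)).comap (T.toPlane n)).pull χ =
      Ideal.span {monomialHom k α β (translation k (dehomogenize k 2 (.X i)))} := by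
  rw [pull_comap, h.comp_toPlane, pull_specMap, pull_centredChart, Ideal.map_span,
    Set.image_singleton]
  rfl

lemma pull_line (h : T.IsMonomialChart n χ α β) :
    ((vanishingIdeal (coordLine k 1)).comap (T.toPlane n)).pull χ =
      (Ideal.span {.X 0 ^ β 0 * .X 1 ^ β 1} : Ideal (MvPolynomial (Fin 2) k)) := by
  rw [h.pull_comap_toPlane, dehomogenize_two_X_one, translation_X_one, monomialHom_X_one]

lemma pull_reducedPreimage (h : T.IsMonomialChart n χ α β) :
    (T.reducedPreimage n).pull χ =
      (Ideal.span {.X 0 ^ min (β 0) 1 * .X 1 ^ min (β 1) 1} : Ideal (MvPolynomial (Fin 2) k)) := by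
  have := h.isOpenImmersion
  rw [reducedPreimage, pull_radical, h.pull_line, radical_span_monomial]

lemma pull_outerLines (h : T.IsMonomialChart n χ α β) :
    ((outerLines k).comap (T.toPlane n)).pull χ =
      (Ideal.span {1 + .X 0 ^ α 0 * .X 1 ^ α 1} : Ideal (MvPolynomial (Fin 2) k)) := by
  rw [outerLines, comap_mul, pull_mul, h.pull_comap_toPlane, h.pull_comap_toPlane,
    dehomogenize_two_X_zero, translation_X_zero, dehomogenize_X_self, map_one, map_one, map_add,
    map_one, monomialHom_X_zero, Ideal.span_singleton_one, Ideal.mul_top]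

end IsMonomialChart

namespace IsAdmissible

variable (hT : T.IsAdmissible N)

include hT

lemma isCoordinateDivisorAt_maxDivisor (hn : n ≤ N) (hN : 0 < N) (x : T.X n) :
    IsCoordinateDivisorAt k (T.maxDivisor n) x := by
  by_cases hx : T.toPlane n x = basePoint k
  · obtain ⟨χ, α, β, h, q, rfl⟩ := hT.exists_isMonomialChart hn x hx
    have := h.isOpenImmersion
    -- This is the function `x`. It equals `1` at points over `[1 : 0 : 1]`, and inverting it
    -- removes the line `X = 0`, which need not be a coordinate axis of the chart.
    let r : MvPolynomial (Fin 2) k := 1 + .X 0 ^ α 0 * .X 1 ^ α 1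
    have hr : r ∉ q.asIdeal := fun hr ↦ (isPrime_asIdeal q).ne_top
      ((Ideal.eq_top_iff_one _).2 ((Ideal.add_mem_iff_left _
        ((h.toPlane_apply_eq_iff q).1 hx).1).1 hr))
    refine ⟨r, fun l ↦ min (β l) 1, shrink χ r, inferInstance, mem_range_shrink χ r q hr,
      fun l ↦ min_le_right _ _, ?_⟩
    rw [pull_shrink, maxDivisor, pull_mul, h.pull_outerLines, h.pull_reducedPreimage,
      Ideal.map_mul, Ideal.map_span, Set.image_singleton, Ideal.span_singleton_eq_top.2,
      Ideal.top_mul]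
    exact IsLocalization.Away.algebraMap_isUnit r
  · let V : (Plane k).Opens := ⟨{basePoint k}ᶜ, (hT.isClosed_basePoint hN).isOpen_compl⟩
    obtain ⟨g, hg, e, hr⟩ := hT.exists_lift_compl hn V (fun h ↦ h rfl)
    obtain ⟨v, rfl⟩ := hr x hx
    obtain ⟨j, q, hq⟩ := exists_planeChart_eq (V.ι v)
    obtain ⟨r, hrq, hrV⟩ := exists_shrink (planeChart k j) q V (hq ▸ v.2)
    let χ := IsOpenImmersion.lift V.ι (shrink (planeChart k j) r)
      (by rw [Scheme.Opens.range_ι]; exact hrV)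
    have hχ : χ ≫ V.ι = shrink (planeChart k j) r := IsOpenImmersion.lift_fac ..
    have : IsOpenImmersion (χ ≫ V.ι) := hχ ▸ inferInstance
    have : IsOpenImmersion χ := IsOpenImmersion.of_comp χ V.ι
    have hpl : (χ ≫ g) ≫ T.toPlane n = shrink (planeChart k j) r := by rw [Category.assoc, e, hχ]
    -- Off the fibre `X n` is an open part of the plane. There the preimage of the triangle is
    -- already reduced, and in a standard chart it is the sum of both axes.
    refine ⟨r, fun _ ↦ 1, χ ≫ g, inferInstance, ?_, fun l ↦ le_rfl, ?_⟩
    · obtain ⟨z, hz⟩ := mem_range_shrink (planeChart k j) r q hrq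
      refine ⟨z, ?_⟩
      rw [Scheme.Hom.comp_apply]
      congr 1
      apply V.ι.isOpenEmbedding.injective
      rw [← hq, ← hz, ← hχ, Scheme.Hom.comp_apply]
    · rw [maxDivisor, pull_mul, reducedPreimage, pull_radical, pull_comap, pull_comap, hpl,
        ← pull_radical, radical_vanishingIdeal, ← pull_mul, ← triangle_eq, pull_shrink,
        pull_triangle, pow_one, pow_one]

/-- On `X 1` the preimage of the line is reduced. -/
lemma reducedPreimage_one (hN : 1 ≤ N) :
    T.reducedPreimage 1 = (vanishingIdeal (coordLine k 1)).comap (T.toPlane 1) := by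
  refine ext_of_comap fun x ↦ ?_
  by_cases hx : T.toPlane 1 x = basePoint k
  · obtain ⟨χ, α, β, h, hxχ⟩ := hT.exists_isMonomialChart hN x hx
    refine ⟨_, χ, h.isOpenImmersion, hxχ, comap_eq_of_pull_eq ?_⟩
    rw [h.pull_reducedPreimage, h.pull_line, min_eq_left (h.le_one le_rfl 0),
      min_eq_left (h.le_one le_rfl 1)]
  · let V : (Plane k).Opens := ⟨{basePoint k}ᶜ, (hT.isClosed_basePoint hN).isOpen_compl⟩
    obtain ⟨g, hg, e, hr⟩ := hT.exists_lift_compl hN V (fun h ↦ h rfl)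
    refine ⟨_, g, hg, hr x hx, ?_⟩
    rw [reducedPreimage, comap_radical, ← comap_comp, e, ← comap_radical, radical_vanishingIdeal]

/-- At the centre both entries of `β` are positive, so the reduced preimage is `X 0 * X 1 = 0`,
whose total transform contains the exceptional axis twice. This fails for `n = 0`, where only one
branch passes through the centre. -/
lemma comap_reducedPreimage (hn1 : 1 ≤ n) (hn : n < N) :
    (T.reducedPreimage n).comap (T.π n) =
      T.reducedPreimage (n + 1) * (T.center n).comap (T.π n) := by
  refine ext_of_comap fun x ↦ ?_
  by_cases hx : T.π n x = T.p n
  · obtain ⟨χ, α, β, h, q, hq⟩ := hT.exists_isMonomialChart hn.le _ (hT.toPlane_center hn)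
    obtain ⟨rfl, hpos⟩ := h.center_eq_origin hT hn hq
    obtain ⟨l, m, hlm, ψ, hψ, e, hxψ⟩ := h.exists_blowup hT hn hq x (hx ▸ ⟨_, hq⟩)
    refine ⟨_, ψ, hψ, hxψ, comap_eq_of_pull_eq ?_⟩
    have h0 := hpos hn1
    have h1 := h.beta_one_pos
    have h' := h.blowup hT hn hq hlm e
    have h0' : 0 < blowupExponent l β 0 := by
      rcases fin_two_ne_cases hlm with ⟨rfl, -⟩ | ⟨rfl, -⟩ <;> simp [blowupExponent, h0]
    rw [pull_comap, e, pull_specMap, h.pull_reducedPreimage, pull_mul, h'.pull_reducedPreimage,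
      pull_comap, e, pull_specMap, h.pull_center hT hn hq, min_eq_right h0, min_eq_right h1,
      min_eq_right h0', min_eq_right h'.beta_one_pos]
    simp only [pow_one]
    exact map_blowupHom_span_mul hlm
  -- Away from the centre the blowup is an isomorphism and the exceptional factor is trivial, so
  -- both sides are the radical of the same ideal sheaf.
  · let U : (T.X n).Opens := ⟨{T.p n}ᶜ, (hT.isClosed_center n hn).isOpen_compl⟩
    have htop : (T.center n).comap U.ι = ⊤ := by
      refine hT.comap_center_eq_top hn _ ?_
      rw [Scheme.Opens.range_ι]
      exact fun h ↦ h rfl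
    obtain ⟨g, hg, e, hr⟩ := (hT.isBlowup n hn).exists_lift_of_comap_eq_top U.ι htop
    refine ⟨_, g, hg, hr x (by rw [Scheme.Opens.range_ι]; exact hx), ?_⟩
    rw [comap_mul, ← comap_comp _ g, ← comap_comp _ g, e, htop, reducedPreimage, reducedPreimage,
      comap_toPlane_succ, comap_radical, comap_radical _ g, ← comap_comp _ g, e]
    exact (mul_one _).symm

/-- Induction from `X 1`, where the product is empty because `L` pulls back to a reduced divisor;
this is why `E_1` is never subtracted. Each further step contributes one factor by
`comap_reducedPreimage`. -/
lemma maxDivisor_mul_prod (hn1 : 1 ≤ n) (hn : n ≤ N) :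
    T.maxDivisor n * ∏ i ∈ Finset.Icc 2 n, T.pullbackE i n =
      (triangle k).comap (T.toPlane n) := by
  induction n, hn1 using Nat.le_induction with
  | base =>
    rw [Finset.Icc_eq_empty (by simp), Finset.prod_empty, mul_one, maxDivisor,
      hT.reducedPreimage_one hn, ← comap_mul, triangle_eq]
  | succ n hn1 ih =>
    have h1 : ∏ i ∈ Finset.Icc 2 n, T.pullbackE i (n + 1) =
        (∏ i ∈ Finset.Icc 2 n, T.pullbackE i n).comap (T.π n) := by
      rw [comap_prod]
      refine Finset.prod_congr rfl fun i hi ↦ ?_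
      rw [pullbackE, if_neg (by have := (Finset.mem_Icc.1 hi).2; omega)]
    rw [Finset.prod_Icc_succ_top (by omega), h1, pullbackE, if_pos rfl, comap_toPlane_succ,
      ← ih (by omega), comap_mul, maxDivisor, maxDivisor, comap_mul,
      hT.comap_reducedPreimage hn1 hn, comap_toPlane_succ]
    ac_rfl

end IsAdmissible

end BlowupTower

end

end

theorem proposition4 {k : Type u} [Field k] (T : BlowupTower k) (N : ℕ) (hT : T.IsAdmissible N) :
    (∀ n, 2 ≤ n → n ≤ N →
      ∃ D : (T.X n).IdealSheafData,
        T.IsMaximalNormalCrossings n D ∧ IsStrictNormalCrossings D ∧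
        D * ∏ i ∈ Finset.Icc 2 n, T.pullbackE i n = (triangle k).comap (T.toPlane n)) ∧
    ((∀ n, 1 ≤ n → n < N → T.p n ∈ T.curve n n) →
      ∀ n, 1 ≤ n → n < N →
        ∃ a b c d : ℕ, FareyNeighbors n a b c d ∧
          IsBlowup (T.π n) (T.center n) ∧ T.IsLocallyDefinedBy n (T.center n) a b c d) := by
  refine ⟨fun n hn2 hn ↦ ⟨T.maxDivisor n, ?_, ?_, hT.maxDivisor_mul_prod (by omega) hn⟩,
    fun h n hn1 hn ↦ hT.exists_isLocallyDefinedBy h hn1 hn⟩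
  · exact BlowupTower.isMaximalNormalCrossings_maxDivisor
      (hT.isCoordinateDivisorAt_maxDivisor hn (by omega))
  · exact IsCoordinateDivisorAt.isStrictNormalCrossings
      (hT.isCoordinateDivisorAt_maxDivisor hn (by omega))
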